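/- For positive integers $s,n$ let $N_{s,n}=n(n+1)s/2$ and define the integers $t_{j,s,n}$ by $$\prod_{j=1}^{n}(1-q^j)^s=\sum_{j=0}^{N_{s,n}}t_{j,s,n}\,q^j ,\qquad \mathcal{M}_{n,s}:=\max_{0\le j\le N_{s,n}}|t_{j,s,n}| .$$ The function $w\mapsto w^{-1}\int_0^w\log\sin(\pi t)\,dt$ attains a maximum on the open interval $\frac12<w<1$, and the constant $$K=\log 2+\max_{1/2<w<1}\left(w^{-1}\int_0^w\log\sin(\pi t)\,dt\right)$$ satisfies $0.19861<K<0.19862$. For every fixed integer $s\ge 1$ and all sufficiently large $n$, $$\mathcal{M}_{n,s}=e^{sKn+O(\log n)}\qquad(n\to\infty),$$ where the threshold for $n$ and the implied constant may depend on $s$. -/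

import Mathlib

open Polynomial

/-- The polynomial `T_{s,n}(q) = ∏_{j=1}^n (1 - q^j)^s`, with integer coefficients. -/
noncomputable def truncProd (s n : ℕ) : ℤ[X] :=
  ∏ j ∈ Finset.Icc 1 n, (1 - X ^ j) ^ s

/-- The degree `N_{s,n} = n (n + 1) s / 2` of `T_{s,n}` (the division is exact). -/
def truncDeg (s n : ℕ) : ℕ := n * (n + 1) * s / 2

/-- The coefficient `t_{j,s,n}` of `q^j` in `T_{s,n}(q)`. -/
noncomputable def truncCoeff (j s n : ℕ) : ℤ := (truncProd s n).coeff j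

/-- `𝓜_{n,s}`, the maximum of `|t_{j,s,n}|` over `0 ≤ j ≤ N_{s,n}`. -/
noncomputable def maxCoeff (n s : ℕ) : ℤ :=
  (Finset.range (truncDeg s n + 1)).sup' Finset.nonempty_range_add_one
    (fun j => |truncCoeff j s n|)

/-- The function `w ↦ w⁻¹ ∫_0^w log sin(πt) dt`. -/
noncomputable def meanLogSin (w : ℝ) : ℝ :=
  w⁻¹ * ∫ t in (0 : ℝ)..w, Real.log (Real.sin (Real.pi * t))

/-!
On the unit circle `|∏ (1 - q ^ j) ^ s|` is the `s`-th power of the Sudler product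
`∏ j ≤ n, |1 - e(jθ)|`, so by Parseval `maxCoeff n s` agrees, up to a factor polynomial in `n`, with
the `s`-th power of the maximum of the Sudler product over `θ`.

For the lower bound take `θ = w / n`, where `w` is the maximizer defining `K`: the logarithm of the
product is then a Riemann sum of the unimodal function `t ↦ log |1 - e(t)|` over `[0, w]`.

For the upper bound replace `log |1 - e(t)|` by `log |1 - r e(t)|`. When `θ` is within `1 / n` of an
integer, the choice `r = 1 - 1 / n` makes the sum a Riemann sum up to `O(log n)`, and the integral
over `[0, x]` is at most `K` times the fractional part of `x`. For other `θ`, fix `r` close to `1`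
and a Dirichlet approximation of `θ` with denominator `q`. In the Fourier expansion the frequencies
not divisible by `q` contribute `O(1)`, apart from a tail of small multiple of `n`, while those
divisible by `q` add up to `1 / q` times the sum for `qθ`. This is at most about `K n / 2`: for
`q ≥ 2` because of the factor `1 / q`, for `q = 1` because the fractional part of `x ≥ 1` is at most
`x / 2`.
-/

open Real intervalIntegral Filter Asymptotics
open MeasureTheory (volume)
open scoped FourierTransform

section RiemannSum

lemma sum_Icc_one_eq_sum_range {M : Type*} [AddCommMonoid M] (f : ℕ → M) (n : ℕ) :
    ∑ j ∈ Finset.Icc 1 n, f j = ∑ j ∈ Finset.range n, f (j + 1) := by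
  rw [Finset.range_eq_Ico, Finset.sum_Ico_add' f 0 n 1]
  rfl

lemma integral_nonpos_of_monotoneOn {g : ℝ → ℝ} {a b w : ℝ} (hmono : MonotoneOn g (Set.Ioo a b))
    (hint : IntervalIntegrable g volume a b) (hab : ∫ t in a..b, g t ≤ 0) (hw : w ∈ Set.Icc a b) :
    ∫ t in a..w, g t ≤ 0 := by
  obtain rfl | haw := hw.1.eq_or_lt
  · simp
  obtain rfl | hwb := hw.2.eq_or_lt
  · exact hab
  have hw' : w ∈ Set.Ioo a b := ⟨haw, hwb⟩
  have hint₁ : IntervalIntegrable g volume a w :=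
    hint.mono_set (Set.uIcc_subset_uIcc_left (by rwa [Set.uIcc_of_le (hw.1.trans hw.2)]))
  have hint₂ : IntervalIntegrable g volume w b :=
    hint.mono_set (Set.uIcc_subset_uIcc_right (by rwa [Set.uIcc_of_le (hw.1.trans hw.2)]))
  rcases le_total (g w) 0 with hgw | hgw
  · calc ∫ t in a..w, g t ≤ ∫ _ in a..w, (0 : ℝ) :=
          integral_mono_on_of_le_Ioo haw.le hint₁ intervalIntegrable_const fun t ht =>
            (hmono ⟨ht.1, ht.2.trans hwb⟩ hw' ht.2.le).trans hgw
      _ = 0 := by simp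
  · have : ∫ _ in w..b, (0 : ℝ) ≤ ∫ t in w..b, g t :=
      integral_mono_on_of_le_Ioo hwb.le intervalIntegrable_const hint₂ fun t ht =>
        hgw.trans (hmono hw' ⟨haw.trans ht.1, ht.2⟩ ht.1.le)
    rw [intervalIntegral.integral_zero] at this
    linarith [integral_add_adjacent_intervals hint₁ hint₂]

variable {f : ℝ → ℝ}

lemma sub_mul_le_integral_add_integral_abs_deriv (hf : ContDiff ℝ 1 f) {a b : ℝ} (hab : a ≤ b) :
    (b - a) * f b ≤ (∫ t in a..b, f t) + (b - a) * ∫ t in a..b, |deriv f t| := by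
  have hf' : Continuous (deriv f) := hf.continuous_deriv_one
  have hle : ∀ t ∈ Set.Icc a b, f b - ∫ x in a..b, |deriv f x| ≤ f t := fun t ht => by
    have hFTC : f b - f t = ∫ x in t..b, deriv f x :=
      (integral_deriv_eq_sub (fun x _ => (hf.differentiable one_ne_zero).differentiableAt)
        (hf'.intervalIntegrable t b)).symm
    have habs : ∫ x in t..b, deriv f x ≤ ∫ x in t..b, |deriv f x| :=
      integral_mono_on ht.2 (hf'.intervalIntegrable _ _) (hf'.abs.intervalIntegrable _ _)
        fun x _ => le_abs_self _
    have hsub : ∫ x in t..b, |deriv f x| ≤ ∫ x in a..b, |deriv f x| :=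
      integral_mono_interval ht.1 ht.2 le_rfl (.of_forall fun x => abs_nonneg _)
        (hf'.abs.intervalIntegrable _ _)
    linarith
  have := integral_mono_on (μ := volume) hab intervalIntegrable_const
    (hf.continuous.intervalIntegrable a b) hle
  rw [integral_const, smul_eq_mul] at this
  linarith

lemma mul_sum_le_integral_add_integral_abs_deriv (hf : ContDiff ℝ 1 f) {η : ℝ} (hη : 0 ≤ η)
    (n : ℕ) :
    η * ∑ j ∈ Finset.Icc 1 n, f (j * η) ≤
      (∫ t in 0..n * η, f t) + η * ∫ t in 0..n * η, |deriv f t| := by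
  have hsum (g : ℝ → ℝ) (hg : Continuous g) :
      ∑ j ∈ Finset.range n, ∫ t in (j : ℕ) * η..(j + 1 : ℕ) * η, g t = ∫ t in 0..n * η, g t := by
    simpa using sum_integral_adjacent_intervals (μ := volume) (f := g)
      (a := fun j : ℕ => j * η) (n := n) fun j _ => hg.intervalIntegrable _ _
  rw [← hsum f hf.continuous, ← hsum _ hf.continuous_deriv_one.abs, Finset.mul_sum,
    Finset.mul_sum, ← Finset.sum_add_distrib, sum_Icc_one_eq_sum_range]
  refine Finset.sum_le_sum fun j _ => ?_
  have hstep : ((j + 1 : ℕ) : ℝ) * η - j * η = η := by push_cast; ring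
  simpa only [hstep] using sub_mul_le_integral_add_integral_abs_deriv hf
    (show (j : ℝ) * η ≤ (j + 1 : ℕ) * η by linarith)

lemma integral_le_add_one_mul_of_periodic {g : ℝ → ℝ} (hper : Function.Periodic g 1)
    (hcont : Continuous g) (hnonneg : ∀ t, 0 ≤ g t) {x : ℝ} (hx : 0 ≤ x) :
    ∫ t in 0..x, g t ≤ (x + 1) * ∫ t in 0..1, g t := by
  have hceil : ∫ t in 0..(⌈x⌉₊ : ℝ), g t = ⌈x⌉₊ * ∫ t in 0..1, g t := by
    simpa using hper.intervalIntegral_add_zsmul_eq ⌈x⌉₊ 0 hcont.intervalIntegrable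
  calc ∫ t in 0..x, g t
      ≤ ∫ t in 0..(⌈x⌉₊ : ℝ), g t := integral_mono_interval le_rfl hx (Nat.le_ceil x)
        (.of_forall hnonneg) (hcont.intervalIntegrable _ _)
    _ = ⌈x⌉₊ * ∫ t in 0..1, g t := hceil
    _ ≤ (x + 1) * ∫ t in 0..1, g t := by
        have := integral_nonneg (μ := volume) zero_le_one fun t _ => hnonneg t
        gcongr
        exact (Nat.ceil_lt_add_one hx).le

lemma integral_abs_deriv_of_monotoneOn (hf : ContDiff ℝ 1 f) {a b : ℝ} (hab : a ≤ b)
    (hmono : MonotoneOn f (Set.Icc a b)) : ∫ t in a..b, |deriv f t| = f b - f a := by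
  have hdiff : Differentiable ℝ f := hf.differentiable one_ne_zero
  rw [← integral_deriv_eq_sub (fun t _ => hdiff t)
    (hf.continuous_deriv_one.intervalIntegrable a b)]
  refine integral_congr_Ioo_of_le hab fun t ht => abs_of_nonneg ?_
  rw [← derivWithin_of_mem_nhds (Icc_mem_nhds ht.1 ht.2)]
  exact hmono.derivWithin_nonneg

lemma integral_abs_deriv_of_antitoneOn (hf : ContDiff ℝ 1 f) {a b : ℝ} (hab : a ≤ b)
    (hanti : AntitoneOn f (Set.Icc a b)) : ∫ t in a..b, |deriv f t| = f a - f b := by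
  have := integral_abs_deriv_of_monotoneOn hf.neg hab hanti.neg
  simp only [deriv.fun_neg, abs_neg] at this
  rw [this]
  ring

lemma integral_le_sub_mul_of_monotoneOn_of_antitoneOn {a b c d : ℝ} (ha : 0 ≤ a) (hab : a ≤ b)
    (hbd : b ≤ d) (hmono : MonotoneOn f (Set.Ioc 0 c)) (hanti : AntitoneOn f (Set.Icc c d))
    (hint : IntervalIntegrable f volume a b) :
    ∫ t in a..b, f t ≤ (b - a) * (f b + (f (max a c) - f (max b c))) := by
  have hle : ∀ t ∈ Set.Ioo a b, f t ≤ f b + (f (max a c) - f (max b c)) := fun t ht => by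
    have ht₀ : 0 < t := ha.trans_lt ht.1
    rcases le_total b c with hbc | hcb
    · rw [max_eq_right hbc, max_eq_right (hab.trans hbc), sub_self, add_zero]
      exact hmono ⟨ht₀, ht.2.le.trans hbc⟩ ⟨ht₀.trans ht.2, hbc⟩ ht.2.le
    rw [max_eq_left hcb, add_sub_cancel]
    rcases le_total t c with htc | hct
    · rw [max_eq_right (ht.1.le.trans htc)]
      exact hmono ⟨ht₀, htc⟩ ⟨ht₀.trans_le htc, le_rfl⟩ htc
    · have hmax : max a c ≤ t := max_le ht.1.le hct
      have htd : t ≤ d := ht.2.le.trans hbd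
      exact hanti ⟨le_max_right a c, hmax.trans htd⟩ ⟨hct, htd⟩ hmax
  have := integral_mono_on_of_le_Ioo hab hint intervalIntegrable_const hle
  rwa [integral_const, smul_eq_mul] at this

lemma integral_le_mul_sum_of_monotoneOn_of_antitoneOn {c h : ℝ} {n : ℕ} (hc : 0 ≤ c) (hh : 0 ≤ h)
    (hcn : c ≤ n * h) (hmono : MonotoneOn f (Set.Ioc 0 c))
    (hanti : AntitoneOn f (Set.Icc c (n * h))) (hint : IntervalIntegrable f volume 0 (n * h)) :
    ∫ t in 0..n * h, f t ≤ h * (∑ j ∈ Finset.Icc 1 n, f (j * h) + (f c - f (n * h))) := by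
  have hle (j : ℕ) : (j : ℝ) * h ≤ (j + 1 : ℕ) * h := by gcongr; omega
  have hlen {j : ℕ} (hj : j < n) : ((j + 1 : ℕ) : ℝ) * h ≤ n * h := by gcongr; omega
  have hint' (j : ℕ) (hj : j < n) :
      IntervalIntegrable f volume ((j : ℕ) * h) ((j + 1 : ℕ) * h) := by
    refine hint.mono_set ?_
    rw [Set.uIcc_of_le (hle j), Set.uIcc_of_le (hc.trans hcn)]
    exact Set.Icc_subset_Icc (by positivity) (hlen hj)
  have hsum := sum_integral_adjacent_intervals hint'
  have htel : ∑ j ∈ Finset.range n, (f (max (j * h) c) - f (max ((j + 1 : ℕ) * h) c)) =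
      f c - f (n * h) := by
    rw [Finset.sum_range_sub' fun j : ℕ => f (max (j * h) c)]
    simp [hc, hcn]
  rw [Nat.cast_zero, zero_mul] at hsum
  rw [← hsum, ← htel, sum_Icc_one_eq_sum_range, ← Finset.sum_add_distrib, Finset.mul_sum]
  refine Finset.sum_le_sum fun j hj => ?_
  rw [Finset.mem_range] at hj
  have hstep : ((j + 1 : ℕ) : ℝ) * h - j * h = h := by push_cast; ring
  simpa only [hstep] using integral_le_sub_mul_of_monotoneOn_of_antitoneOn
    (by positivity) (hle j) (hlen hj) hmono hanti (hint' j hj)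

end RiemannSum

section SinPi

lemma sin_pi_mul_pos {t : ℝ} (ht : t ∈ Set.Ioo 0 1) : 0 < sin (π * t) :=
  sin_pos_of_pos_of_lt_pi (mul_pos pi_pos ht.1) (mul_lt_of_lt_one_right pi_pos ht.2)

lemma sin_pi_mul_nonneg {t : ℝ} (ht : t ∈ Set.Icc 0 1) : 0 ≤ sin (π * t) :=
  sin_nonneg_of_nonneg_of_le_pi (mul_nonneg pi_pos.le ht.1) (mul_le_of_le_one_right pi_pos.le ht.2)

lemma monotoneOn_sin_pi_mul : MonotoneOn (fun t => sin (π * t)) (Set.Icc 0 (1 / 2)) :=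
  fun s hs t ht hst => sin_le_sin_of_le_of_le_pi_div_two (by nlinarith [pi_pos, hs.1])
    (by nlinarith [pi_pos, ht.2]) (by gcongr)

lemma antitoneOn_sin_pi_mul : AntitoneOn (fun t => sin (π * t)) (Set.Icc (1 / 2) 1) := by
  intro s hs t ht hst
  have := monotoneOn_sin_pi_mul (a := 1 - t) (b := 1 - s) ⟨by linarith [ht.2], by linarith [ht.1]⟩
    ⟨by linarith [hs.2], by linarith [hs.1]⟩ (by linarith)
  simpa only [mul_sub, mul_one, sin_pi_sub] using this

end SinPi

section LogDist

lemma norm_one_sub_mul_fourierChar_sq (r t : ℝ) :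
    ‖1 - (r : ℂ) * 𝐞 t‖ ^ 2 = (1 - r) ^ 2 + 4 * r * sin (π * t) ^ 2 := by
  have hsub : 1 - (r : ℂ) * 𝐞 t =
      ((1 - r * cos (2 * π * t) : ℝ) : ℂ) + ((-(r * sin (2 * π * t)) : ℝ) : ℂ) * Complex.I := by
    rw [fourierChar_apply, Complex.exp_mul_I, ← Complex.ofReal_cos, ← Complex.ofReal_sin]
    push_cast
    ring
  have hcos : cos (2 * π * t) = 1 - 2 * sin (π * t) ^ 2 := by
    rw [mul_assoc, cos_two_mul, cos_sq']
    ring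
  rw [hsub, Complex.sq_norm, Complex.normSq_add_mul_I]
  linear_combination r ^ 2 * sin_sq_add_cos_sq (2 * π * t) - 2 * r * hcos

lemma one_sub_mul_fourierChar_ne_zero_of_lt_one {r : ℝ} (hr : |r| < 1) (t : ℝ) :
    1 - (r : ℂ) * 𝐞 t ≠ 0 := fun h => by
  have := congrArg norm (sub_eq_zero.1 h)
  rw [norm_one, norm_mul, Circle.norm_coe, mul_one, Complex.norm_real, norm_eq_abs] at this
  exact hr.ne this.symm

lemma one_sub_mul_fourierChar_ne_zero_of_mem_Ioo {r : ℝ} (hr : 0 ≤ r) {t : ℝ}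
    (ht : t ∈ Set.Ioo 0 1) : 1 - (r : ℂ) * 𝐞 t ≠ 0 := by
  rw [← norm_ne_zero_iff, ← sq_pos_iff, norm_one_sub_mul_fourierChar_sq]
  have := sin_pi_mul_pos ht
  rcases hr.eq_or_lt with rfl | hr
  · norm_num
  · positivity

lemma norm_one_sub_mul_fourierChar_le {r : ℝ} (hr : 0 ≤ r) {s t : ℝ} (hs : 0 ≤ sin (π * s))
    (hst : sin (π * s) ≤ sin (π * t)) : ‖1 - (r : ℂ) * 𝐞 s‖ ≤ ‖1 - (r : ℂ) * 𝐞 t‖ := by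
  rw [← pow_le_pow_iff_left₀ (norm_nonneg _) (norm_nonneg _) two_ne_zero,
    norm_one_sub_mul_fourierChar_sq, norm_one_sub_mul_fourierChar_sq]
  gcongr

/-- The logarithm of the distance from `1` to the point `r * 𝐞 t` of the circle of radius `r`.
For `r = 1` this takes the junk value `log 0 = 0` at the integers `t`, where the logarithm has a
singularity. -/
noncomputable def logDist (r t : ℝ) : ℝ := log ‖1 - (r : ℂ) * 𝐞 t‖

variable {r : ℝ}

lemma logDist_eq_log_div_two (r t : ℝ) :
    logDist r t = log ((1 - r) ^ 2 + 4 * r * sin (π * t) ^ 2) / 2 := by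
  rw [← norm_one_sub_mul_fourierChar_sq, log_pow, logDist]
  push_cast
  ring

lemma logDist_one_left (t : ℝ) : logDist 1 t = log (2 * sin (π * t)) := by
  rw [logDist_eq_log_div_two, show (1 - 1 : ℝ) ^ 2 + 4 * 1 * sin (π * t) ^ 2 =
    (2 * sin (π * t)) ^ 2 by ring, log_pow]
  push_cast
  ring

lemma logDist_zero_right (r : ℝ) : logDist r 0 = log (1 - r) := by
  rw [logDist_eq_log_div_two, mul_zero, sin_zero, zero_pow two_ne_zero, mul_zero, add_zero,
    log_pow]
  push_cast
  ring

lemma periodic_logDist (r : ℝ) : Function.Periodic (logDist r) 1 := fun t => by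
  rw [logDist_eq_log_div_two, logDist_eq_log_div_two, mul_add, mul_one, sin_add_pi, neg_sq]

lemma logDist_neg (r t : ℝ) : logDist r (-t) = logDist r t := by
  rw [logDist_eq_log_div_two, logDist_eq_log_div_two, mul_neg, sin_neg, neg_sq]

lemma logDist_one_sub (r t : ℝ) : logDist r (1 - t) = logDist r t := by
  rw [(periodic_logDist r).sub_eq', logDist_neg]

lemma logDist_le_log_two (hr : |r| ≤ 1) (t : ℝ) : logDist r t ≤ log 2 := by
  rcases eq_or_ne (1 - (r : ℂ) * 𝐞 t) 0 with h0 | h0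
  · rw [logDist, h0, norm_zero, log_zero]
    positivity
  · refine log_le_log (norm_pos_iff.2 h0) ((norm_sub_le _ _).trans ?_)
    rw [norm_one, norm_mul, Circle.norm_coe, Complex.norm_real, norm_eq_abs]
    linarith

lemma log_one_sub_le_logDist (hr₀ : 0 ≤ r) (hr₁ : r < 1) (t : ℝ) : log (1 - r) ≤ logDist r t := by
  refine log_le_log (by linarith) ?_
  have := norm_sub_norm_le 1 ((r : ℂ) * 𝐞 t)
  rwa [norm_one, norm_mul, Circle.norm_coe, mul_one, Complex.norm_real, norm_of_nonneg hr₀] at this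

lemma monotoneOn_logDist (hr : 0 ≤ r) {S : Set ℝ} (hS : S ⊆ Set.Icc 0 (1 / 2))
    (hne : ∀ t ∈ S, 1 - (r : ℂ) * 𝐞 t ≠ 0) : MonotoneOn (logDist r) S := fun s hs t ht hst =>
  log_le_log (norm_pos_iff.2 (hne s hs)) (norm_one_sub_mul_fourierChar_le hr
    (sin_pi_mul_nonneg ⟨(hS hs).1, (hS hs).2.trans (by norm_num)⟩)
    (monotoneOn_sin_pi_mul (hS hs) (hS ht) hst))

lemma antitoneOn_logDist (hr : 0 ≤ r) {S : Set ℝ} (hS : S ⊆ Set.Icc (1 / 2) 1)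
    (hne : ∀ t ∈ S, 1 - (r : ℂ) * 𝐞 t ≠ 0) : AntitoneOn (logDist r) S := fun s hs t ht hst =>
  log_le_log (norm_pos_iff.2 (hne t ht)) (norm_one_sub_mul_fourierChar_le hr
    (sin_pi_mul_nonneg ⟨le_trans (by norm_num) (hS ht).1, (hS ht).2⟩)
    (antitoneOn_sin_pi_mul (hS hs) (hS ht) hst))

lemma monotoneOn_logDist_sub_logDist_one (hr : 0 ≤ r) :
    MonotoneOn (fun t => logDist r t - logDist 1 t) (Set.Ioo (1 / 2) 1) := by
  intro s hs t ht hst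
  have hs' : s ∈ Set.Ioo 0 1 := ⟨one_half_pos.trans hs.1, hs.2⟩
  have ht' : t ∈ Set.Ioo 0 1 := ⟨one_half_pos.trans ht.1, ht.2⟩
  have hle : sin (π * t) ≤ sin (π * s) :=
    antitoneOn_sin_pi_mul (Set.Ioo_subset_Icc_self hs) (Set.Ioo_subset_Icc_self ht) hst
  have hpos := sin_pi_mul_pos ht'
  have hNs := norm_pos_iff.2 (one_sub_mul_fourierChar_ne_zero_of_mem_Ioo hr hs')
  have hNt := norm_pos_iff.2 (one_sub_mul_fourierChar_ne_zero_of_mem_Ioo hr ht')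
  have hMs := norm_pos_iff.2 (one_sub_mul_fourierChar_ne_zero_of_mem_Ioo zero_le_one hs')
  have hMt := norm_pos_iff.2 (one_sub_mul_fourierChar_ne_zero_of_mem_Ioo zero_le_one ht')
  have key : (‖1 - (r : ℂ) * 𝐞 s‖ * ‖1 - ((1 : ℝ) : ℂ) * 𝐞 t‖) ^ 2 ≤
      (‖1 - (r : ℂ) * 𝐞 t‖ * ‖1 - ((1 : ℝ) : ℂ) * 𝐞 s‖) ^ 2 := by
    simp only [mul_pow, norm_one_sub_mul_fourierChar_sq]
    have : sin (π * t) ^ 2 ≤ sin (π * s) ^ 2 := by gcongr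
    nlinarith [sq_nonneg (1 - r)]
  have := log_le_log (by positivity) (le_of_sq_le_sq key (by positivity))
  rw [log_mul hNs.ne' hMt.ne', log_mul hNt.ne' hMs.ne'] at this
  simp only [logDist]
  linarith

lemma contDiff_logDist {n : WithTop ℕ∞} (hr : |r| < 1) : ContDiff ℝ n (logDist r) := by
  rw [funext (logDist_eq_log_div_two r)]
  refine ContDiff.div_const (ContDiff.log (by fun_prop) fun t => ?_) 2
  rw [← norm_one_sub_mul_fourierChar_sq]
  exact pow_ne_zero 2 (norm_ne_zero_iff.2 (one_sub_mul_fourierChar_ne_zero_of_lt_one hr t))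

lemma intervalIntegrable_logDist (r a b : ℝ) : IntervalIntegrable (logDist r) volume a b := by
  rw [funext (logDist_eq_log_div_two r)]
  refine IntervalIntegrable.div_const (MeromorphicOn.intervalIntegrable_log fun t _ =>
    AnalyticAt.meromorphicAt ?_) 2
  fun_prop

lemma circleAverage_eq_integral_fourierChar {E : Type*} [NormedAddCommGroup E] [NormedSpace ℝ E]
    (f : ℂ → E) : circleAverage f 0 1 = ∫ t in 0..1, f (𝐞 t) := by
  have := smul_integral_comp_mul_left (fun θ => f (circleMap 0 1 θ)) (2 * π) (a := 0) (b := 1)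
  rw [mul_zero, mul_one] at this
  rw [circleAverage_def, ← this, inv_smul_smul₀ two_pi_pos.ne']
  simp [circleMap, fourierChar_apply]

lemma integral_logDist_zero_one (hr : |r| ≤ 1) : ∫ t in 0..1, logDist r t = 0 := by
  have hnorm (t : ℝ) : log ‖(𝐞 t : ℂ) - r‖ = logDist r t := by
    have hmul : (𝐞 t : ℂ) * (1 - r * 𝐞 (-t)) = 𝐞 t - r := by
      rw [mul_sub, mul_left_comm, ← Circle.coe_mul, ← AddChar.map_add_eq_mul, add_neg_cancel,
        AddChar.map_zero_eq_one, Circle.coe_one, mul_one, mul_one]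
    rw [← logDist_neg, logDist, ← hmul, norm_mul, Circle.norm_coe, one_mul]
  rw [← integral_congr fun t _ => hnorm t,
    ← circleAverage_eq_integral_fourierChar fun z => log ‖z - r‖,
    circleAverage_log_norm_sub_const_eq_posLog, posLog_eq_zero_iff]
  simpa using hr

lemma integral_logDist_zero_half (hr : |r| ≤ 1) : ∫ t in 0..1 / 2, logDist r t = 0 := by
  have hadd := integral_add_adjacent_intervals (intervalIntegrable_logDist r 0 (1 / 2))
    (intervalIntegrable_logDist r (1 / 2) 1)
  have hsymm : ∫ t in 1 / 2..1, logDist r t = ∫ t in 0..1 / 2, logDist r t := by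
    have := integral_comp_sub_left (logDist r) 1 (a := 0) (b := 1 / 2)
    simp only [logDist_one_sub] at this
    rw [this]
    norm_num
  rw [integral_logDist_zero_one hr, hsymm] at hadd
  linarith

lemma integral_logDist_fract (hr : |r| ≤ 1) (x : ℝ) :
    ∫ t in 0..Int.fract x, logDist r t = ∫ t in 0..x, logDist r t := by
  have hper := (periodic_logDist r).intervalIntegral_add_zsmul_eq ⌊x⌋ (Int.fract x)
    (intervalIntegrable_logDist r)
  rw [(periodic_logDist r).intervalIntegral_add_eq (Int.fract x) 0, zero_add,
    integral_logDist_zero_one hr, zsmul_zero, zsmul_one, Int.fract_add_floor] at hper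
  rw [← integral_add_adjacent_intervals (intervalIntegrable_logDist r 0 (Int.fract x))
    (intervalIntegrable_logDist r (Int.fract x) x), hper, add_zero]

lemma integral_logDist_nonpos (hr₀ : 0 ≤ r) (hr₁ : r ≤ 1) {w : ℝ} (hw : w ∈ Set.Icc 0 (1 / 2)) :
    ∫ t in 0..w, logDist r t ≤ 0 :=
  integral_nonpos_of_monotoneOn
    (monotoneOn_logDist hr₀ Set.Ioo_subset_Icc_self fun t ht =>
      one_sub_mul_fourierChar_ne_zero_of_mem_Ioo hr₀ ⟨ht.1, ht.2.trans one_half_lt_one⟩)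
    (intervalIntegrable_logDist r 0 (1 / 2))
    (integral_logDist_zero_half (abs_le.2 ⟨by linarith, hr₁⟩)).le hw

lemma integral_logDist_le_integral_logDist_one (hr₀ : 0 ≤ r) (hr₁ : r ≤ 1) {w : ℝ}
    (hw : w ∈ Set.Icc (1 / 2) 1) : ∫ t in 0..w, logDist r t ≤ ∫ t in 0..w, logDist 1 t := by
  have hint (a b : ℝ) := (intervalIntegrable_logDist r a b).sub (intervalIntegrable_logDist 1 a b)
  have hsub (a b : ℝ) : ∫ t in a..b, (logDist r t - logDist 1 t) =
      (∫ t in a..b, logDist r t) - ∫ t in a..b, logDist 1 t :=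
    integral_sub (intervalIntegrable_logDist r a b) (intervalIntegrable_logDist 1 a b)
  have hr : |r| ≤ 1 := abs_le.2 ⟨by linarith, hr₁⟩
  have h0_half : ∫ t in 0..1 / 2, (logDist r t - logDist 1 t) = 0 := by
    rw [hsub, integral_logDist_zero_half hr, integral_logDist_zero_half (by simp), sub_zero]
  have h0_one : ∫ t in 0..1, (logDist r t - logDist 1 t) = 0 := by
    rw [hsub, integral_logDist_zero_one hr, integral_logDist_zero_one (by simp), sub_zero]
  have hhalf_one : ∫ t in 1 / 2..1, (logDist r t - logDist 1 t) ≤ 0 := by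
    linarith [integral_add_adjacent_intervals (hint 0 (1 / 2)) (hint (1 / 2) 1)]
  have hhalf_w : ∫ t in 1 / 2..w, (logDist r t - logDist 1 t) ≤ 0 :=
    integral_nonpos_of_monotoneOn (monotoneOn_logDist_sub_logDist_one hr₀) (hint _ _) hhalf_one hw
  rw [← sub_nonpos, ← hsub, ← integral_add_adjacent_intervals (hint 0 (1 / 2)) (hint (1 / 2) w)]
  linarith

lemma intervalIntegrable_log_sin_pi_mul (a b : ℝ) :
    IntervalIntegrable (fun t => log (sin (π * t))) volume a b :=
  MeromorphicOn.intervalIntegrable_log fun t _ => by fun_prop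

lemma integral_logDist_one {w : ℝ} (hw : w ∈ Set.Ioc 0 1) :
    ∫ t in 0..w, logDist 1 t = w * (log 2 + meanLogSin w) := by
  have hmul : Set.EqOn (logDist 1) (fun t => log 2 + log (sin (π * t))) (Set.Ioo 0 w) :=
    fun t ht => by
      rw [logDist_one_left,
        log_mul two_ne_zero (sin_pi_mul_pos ⟨ht.1, ht.2.trans_le hw.2⟩).ne']
  rw [integral_congr_Ioo_of_le hw.1.le hmul, integral_add intervalIntegrable_const
    (intervalIntegrable_log_sin_pi_mul 0 w), integral_const, sub_zero, smul_eq_mul, meanLogSin,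
    mul_add, mul_inv_cancel_left₀ hw.1.ne']

end LogDist

section LogSin

lemma abs_sin_sub_septic_le {x : ℝ} (hx : |x| ≤ 1) :
    |sin x - (x - x ^ 3 / 6 + x ^ 5 / 120 - x ^ 7 / 5040)| ≤ |x| ^ 8 / 35840 := by
  have hexp := Complex.exp_bound (x := x * Complex.I) (n := 8) (by simpa using hx) (by norm_num)
  have hsum : ∑ m ∈ Finset.range 8, (x * Complex.I) ^ m / m.factorial =
      ((1 - x ^ 2 / 2 + x ^ 4 / 24 - x ^ 6 / 720 : ℝ) : ℂ) +
        ((x - x ^ 3 / 6 + x ^ 5 / 120 - x ^ 7 / 5040 : ℝ) : ℂ) * Complex.I := by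
    norm_num [Finset.sum_range_succ, Nat.factorial, mul_pow, Complex.I_pow_eq_pow_mod 4,
      Complex.I_pow_eq_pow_mod 5, Complex.I_pow_eq_pow_mod 6, Complex.I_pow_eq_pow_mod 7,
      Complex.I_pow_three]
    ring
  have him := (Complex.abs_im_le_norm _).trans hexp
  rw [hsum] at him
  norm_num [Complex.exp_ofReal_mul_I_im, ← Complex.ofReal_pow, Nat.factorial] at him
  rwa [mul_one_div] at him

lemma abs_exp_neg_sub_quartic_le {u : ℝ} (hu₀ : 0 ≤ u) (hu₁ : u ≤ 1) :
    |exp (-u) - (1 - u + u ^ 2 / 2 - u ^ 3 / 6 + u ^ 4 / 24)| ≤ u ^ 5 / 100 := by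
  have h := exp_bound (x := -u) (n := 5) (by rwa [abs_neg, abs_of_nonneg hu₀]) (by norm_num)
  rw [abs_neg, abs_of_nonneg hu₀] at h
  norm_num [Finset.sum_range_succ, Nat.factorial, Odd.neg_pow (n := 3) (by decide)] at h
  convert h using 2 <;> ring

lemma pow_add_four_le {y : ℝ} (hy₀ : 0 ≤ y) (hy₁ : y ≤ 1 / 2) (k : ℕ) :
    y ^ (k + 4) ≤ y ^ 3 / 2 := by
  rw [show k + 4 = 3 + (k + 1) by ring, pow_add, div_eq_mul_one_div]
  gcongr
  exact (pow_le_of_le_one hy₀ (by linarith) k.succ_ne_zero).trans hy₁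

lemma sin_le_mul_exp {x : ℝ} (hx₀ : 0 ≤ x) (hx₁ : x ≤ 7 / 10) :
    sin x ≤ x * exp (-(x ^ 2 / 6 + x ^ 4 / 180)) := by
  obtain ⟨y, hy⟩ : ∃ y, y = x ^ 2 := ⟨_, rfl⟩
  have hy₀ : 0 ≤ y := hy ▸ sq_nonneg x
  have hy₁ : y ≤ 1 / 2 := by nlinarith
  have hpoly : 1 - y / 6 + y ^ 2 / 120 - y ^ 3 / 5040 + y ^ 3 / 51200 ≤
      exp (-(y / 6 + y ^ 2 / 180)) := by
    have hexp := (abs_le.1 (abs_exp_neg_sub_quartic_le (u := y / 6 + y ^ 2 / 180)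
      (by positivity) (by nlinarith))).1
    have hpow := pow_add_four_le hy₀ hy₁
    have := pow_nonneg hy₀ 3
    have := pow_nonneg hy₀ 5
    linarith [hpow 0, hpow 2, hpow 3, hpow 4, hpow 5, hpow 6]
  have hsin := (abs_le.1 (abs_sin_sub_septic_le (x := x) (abs_le.2 ⟨by linarith, by linarith⟩))).2
  have hx8 : x ^ 8 ≤ x ^ 7 * (7 / 10) := by rw [pow_succ]; gcongr
  calc sin x ≤ x * (1 - y / 6 + y ^ 2 / 120 - y ^ 3 / 5040 + y ^ 3 / 51200) := by
        rw [abs_of_nonneg hx₀] at hsin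
        rw [hy]
        linarith
    _ ≤ x * exp (-(y / 6 + y ^ 2 / 180)) := by gcongr
    _ = x * exp (-(x ^ 2 / 6 + x ^ 4 / 180)) := by rw [hy, ← pow_mul]

lemma mul_exp_le_sin {x : ℝ} (hx₀ : 0 ≤ x) (hx₁ : x ≤ 7 / 10) :
    x * exp (-(x ^ 2 / 6 + x ^ 4 / 180 + x ^ 6 / 2500)) ≤ sin x := by
  obtain ⟨y, hy⟩ : ∃ y, y = x ^ 2 := ⟨_, rfl⟩
  have hy₀ : 0 ≤ y := hy ▸ sq_nonneg x
  have hy₁ : y ≤ 1 / 2 := by nlinarith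
  have hpoly : exp (-(y / 6 + y ^ 2 / 180 + y ^ 3 / 2500)) ≤
      1 - y / 6 + y ^ 2 / 120 - y ^ 3 / 5040 - y ^ 3 / 51200 := by
    have hexp := (abs_le.1 (abs_exp_neg_sub_quartic_le (u := y / 6 + y ^ 2 / 180 + y ^ 3 / 2500)
      (by positivity) (by nlinarith [pow_le_one₀ hy₀ (by linarith : y ≤ 1) (n := 3)]))).2
    have hpow := pow_add_four_le hy₀ hy₁
    have := pow_nonneg hy₀ 3
    have := pow_nonneg hy₀ 5
    linarith [hpow 0, hpow 2, hpow 3, hpow 4, hpow 5, hpow 6, hpow 7, hpow 8, hpow 9,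
      hpow 10, hpow 11]
  have hsin := (abs_le.1 (abs_sin_sub_septic_le (x := x) (abs_le.2 ⟨by linarith, by linarith⟩))).1
  have hx8 : x ^ 8 ≤ x ^ 7 * (7 / 10) := by rw [pow_succ]; gcongr
  calc x * exp (-(x ^ 2 / 6 + x ^ 4 / 180 + x ^ 6 / 2500))
      = x * exp (-(y / 6 + y ^ 2 / 180 + y ^ 3 / 2500)) := by rw [hy, ← pow_mul, ← pow_mul]
    _ ≤ x * (1 - y / 6 + y ^ 2 / 120 - y ^ 3 / 5040 - y ^ 3 / 51200) := by gcongr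
    _ ≤ sin x := by
        rw [abs_of_nonneg hx₀] at hsin
        rw [hy]
        linarith

lemma log_sin_le {x : ℝ} (hx₀ : 0 < x) (hx₁ : x ≤ 7 / 10) :
    log (sin x) ≤ log x - (x ^ 2 / 6 + x ^ 4 / 180) := by
  have hlog := log_le_log (sin_pos_of_pos_of_lt_pi hx₀ (by linarith [pi_gt_three]))
    (sin_le_mul_exp hx₀.le hx₁)
  rwa [log_mul hx₀.ne' (exp_pos _).ne', log_exp] at hlog

lemma le_log_sin {x : ℝ} (hx₀ : 0 < x) (hx₁ : x ≤ 7 / 10) :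
    log x - (x ^ 2 / 6 + x ^ 4 / 180 + x ^ 6 / 2500) ≤ log (sin x) := by
  have hlog := log_le_log (by positivity) (mul_exp_le_sin hx₀.le hx₁)
  rwa [log_mul hx₀.ne' (exp_pos _).ne', log_exp] at hlog

end LogSin

section Lobachevsky

lemma intervalIntegrable_log_two_mul_sin (a b : ℝ) :
    IntervalIntegrable (fun t => log (2 * sin t)) volume a b :=
  MeromorphicOn.intervalIntegrable_log fun t _ => by fun_prop

/-- The Lobachevsky function `Λ`, which turns `w * (log 2 + meanLogSin w)` into
`Λ (π * (1 - w)) / π`. -/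
noncomputable def lobachevsky (x : ℝ) : ℝ := -∫ t in 0..x, log (2 * sin t)

lemma lobachevsky_sub_lobachevsky (x y : ℝ) :
    lobachevsky x - lobachevsky y = ∫ t in x..y, log (2 * sin t) := by
  have := integral_add_adjacent_intervals (intervalIntegrable_log_two_mul_sin 0 x)
    (intervalIntegrable_log_two_mul_sin x y)
  unfold lobachevsky
  linarith

lemma pi_mul_integral_logDist_one (w : ℝ) :
    π * ∫ t in 0..w, logDist 1 t = lobachevsky (π * (1 - w)) := by
  have hadd := integral_add_adjacent_intervals (intervalIntegrable_logDist 1 0 w)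
    (intervalIntegrable_logDist 1 w 1)
  have hreflect := integral_comp_sub_left (logDist 1) (1 : ℝ) (a := 0) (b := 1 - w)
  have hscale := mul_integral_comp_mul_left (a := 0) (b := 1 - w) (c := π)
    (f := fun t => log (2 * sin t))
  simp only [logDist_one_sub, sub_zero, sub_sub_cancel] at hreflect
  rw [integral_logDist_zero_one (by norm_num), ← hreflect] at hadd
  simp only [mul_zero, ← logDist_one_left] at hscale
  rw [lobachevsky, ← hscale, ← mul_neg, eq_neg_of_add_eq_zero_left hadd]

lemma lobachevsky_le_tangent {x y : ℝ} (hx : x ∈ Set.Ioc 0 (π / 2)) (hy : y ∈ Set.Icc 0 (π / 2)) :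
    lobachevsky y ≤ lobachevsky x + (x - y) * log (2 * sin x) := by
  have hmono {s t : ℝ} (hs : 0 < s) (hst : s ≤ t) (ht : t ≤ π / 2) :
      log (2 * sin s) ≤ log (2 * sin t) := by
    have := sin_pos_of_pos_of_lt_pi hs (by linarith [pi_pos])
    have := sin_le_sin_of_le_of_le_pi_div_two (by linarith [pi_pos]) ht hst
    gcongr
  rw [← sub_le_iff_le_add', lobachevsky_sub_lobachevsky]
  rcases le_total y x with hyx | hxy
  · have := integral_mono_on_of_le_Ioo hyx (intervalIntegrable_log_two_mul_sin y x)
      intervalIntegrable_const fun t ht => hmono (hy.1.trans_lt ht.1) ht.2.le hx.2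
    rwa [integral_const, smul_eq_mul] at this
  · have := integral_mono_on_of_le_Ioo hxy intervalIntegrable_const
      (intervalIntegrable_log_two_mul_sin x y)
      fun t ht => hmono hx.1 ht.1.le (ht.2.le.trans hy.2)
    rw [integral_const, smul_eq_mul] at this
    rw [integral_symm]
    linarith

lemma intervalIntegrable_log_sub_sextic (c x : ℝ) :
    IntervalIntegrable (fun t => log 2 + log t - (t ^ 2 / 6 + t ^ 4 / 180 + c * t ^ 6))
      volume 0 x :=
  (intervalIntegrable_const.add intervalIntegrable_log').sub
    (Continuous.intervalIntegrable (by fun_prop) _ _)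

lemma integral_log_sub_sextic (c : ℝ) {x : ℝ} (hx : 0 < x) :
    ∫ t in 0..x, (log 2 + log t - (t ^ 2 / 6 + t ^ 4 / 180 + c * t ^ 6)) =
      x * log (2 * x) - x - (x ^ 3 / 18 + x ^ 5 / 900 + c * x ^ 7 / 7) := by
  have hpow (d : ℝ) (k : ℕ) : IntervalIntegrable (fun t => d * t ^ k) volume 0 x :=
    Continuous.intervalIntegrable (by fun_prop) _ _
  have hpoly : ∫ t in 0..x, (t ^ 2 / 6 + t ^ 4 / 180 + c * t ^ 6) =
      x ^ 3 / 18 + x ^ 5 / 900 + c * x ^ 7 / 7 := by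
    simp only [div_eq_inv_mul]
    rw [integral_add ((hpow _ 2).add (hpow _ 4)) (hpow c 6), integral_add (hpow _ 2) (hpow _ 4)]
    simp only [intervalIntegral.integral_const_mul, integral_pow]
    norm_num
    ring
  rw [integral_sub (intervalIntegrable_const.add intervalIntegrable_log')
    (Continuous.intervalIntegrable (by fun_prop) _ _), hpoly,
    integral_add intervalIntegrable_const intervalIntegrable_log', integral_log_from_zero,
    integral_const, log_mul two_ne_zero hx.ne', smul_eq_mul]
  ring

lemma lobachevsky_le {x : ℝ} (hx₀ : 0 < x) (hx₁ : x ≤ 7 / 10) :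
    lobachevsky x ≤ x - x * log (2 * x) + (x ^ 3 / 18 + x ^ 5 / 900 + x ^ 7 / 17500) := by
  have hle := integral_mono_on_of_le_Ioo hx₀.le (intervalIntegrable_log_sub_sextic (1 / 2500) x)
    (intervalIntegrable_log_two_mul_sin 0 x) fun t ht => by
      have := sin_pos_of_pos_of_lt_pi ht.1 (by linarith [ht.2, pi_gt_three])
      rw [log_mul two_ne_zero this.ne']
      linarith [le_log_sin ht.1 (ht.2.le.trans hx₁)]
  rw [integral_log_sub_sextic _ hx₀] at hle
  unfold lobachevsky
  linarith

lemma le_lobachevsky {x : ℝ} (hx₀ : 0 < x) (hx₁ : x ≤ 7 / 10) :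
    x - x * log (2 * x) + (x ^ 3 / 18 + x ^ 5 / 900) ≤ lobachevsky x := by
  have hle := integral_mono_on_of_le_Ioo hx₀.le (intervalIntegrable_log_two_mul_sin 0 x)
    (intervalIntegrable_log_sub_sextic 0 x) fun t ht => by
      have := sin_pos_of_pos_of_lt_pi ht.1 (by linarith [ht.2, pi_gt_three])
      rw [log_mul two_ne_zero this.ne']
      linarith [log_sin_le ht.1 (ht.2.le.trans hx₁)]
  rw [integral_log_sub_sextic _ hx₀] at hle
  unfold lobachevsky
  linarith

end Lobachevsky

section GrowthConstant

-- `0.655885` is `π * (1 - w)` rounded to six digits, where `w` is the maximizer of `meanLogSin`.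
lemma abs_log_two_mul_sub_le : |log (2 * 0.655885) - 0.271377370276| ≤ 1 / 10 ^ 8 := by
  have hsplit : log (2 * 0.655885) = 2 * log 2 - log 3 + log (1 - 0.0161725) := by
    rw [← log_rpow two_pos, ← log_div (by norm_num) (by norm_num),
      ← log_mul (by norm_num) (by norm_num)]
    norm_num
  have htaylor := abs_log_sub_add_sum_range_le (x := 0.0161725) (by norm_num [abs_lt]) 4
  have hlog3 := abs_le.1 log_three_near_10
  have hlog2 := And.intro log_two_gt_d9 log_two_lt_d9
  rw [hsplit]
  norm_num [Finset.sum_range_succ, abs_le] at htaylor hlog3 ⊢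
  constructor <;> linarith [htaylor.1, htaylor.2, hlog3.1, hlog3.2, hlog2.1, hlog2.2]

lemma abs_log_two_mul_sin_sub_le : |log (2 * sin 0.655885) - 0.198622| ≤ 3 / 10 ^ 6 := by
  have hsin : 0 < sin 0.655885 :=
    sin_pos_of_pos_of_lt_pi (by norm_num) (by linarith [pi_gt_three])
  rw [abs_le]
  constructor
  · have hlog := (abs_le.1 abs_log_two_mul_sub_le).1
    rw [log_mul two_ne_zero (by norm_num)] at hlog
    have := le_log_sin (x := 0.655885) (by norm_num) (by norm_num)
    rw [log_mul two_ne_zero hsin.ne']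
    norm_num at hlog this ⊢
    linarith
  · have hle := (abs_le.1 (abs_sin_sub_septic_le (x := 0.655885) (by norm_num [abs_le]))).2
    have hexp := sum_le_exp_of_nonneg (x := 0.198625) (by norm_num) 7
    rw [sub_le_iff_le_add, log_le_iff_le_exp (by positivity)]
    norm_num [Finset.sum_range_succ, Nat.factorial, abs_of_pos] at hle hexp ⊢
    linarith

lemma pi_mul_log_two_add_meanLogSin {w : ℝ} (hw : w ∈ Set.Ioc 0 1) :
    π * w * (log 2 + meanLogSin w) = lobachevsky (π * (1 - w)) := by
  rw [← pi_mul_integral_logDist_one, integral_logDist_one hw, mul_assoc]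

lemma log_two_add_meanLogSin_lt {w : ℝ} (hw : w ∈ Set.Icc (1 / 2) 1) :
    log 2 + meanLogSin w < 0.19862 := by
  have hw₀ : 0 < w := by linarith [hw.1]
  obtain ⟨y, hy⟩ : ∃ y, y = π * (1 - w) := ⟨_, rfl⟩
  have hy₀ : 0 ≤ y := hy ▸ mul_nonneg pi_pos.le (by linarith [hw.2])
  have hy₁ : y ≤ π / 2 := by nlinarith [pi_pos, hw.1]
  have htangent := lobachevsky_le_tangent (x := 0.655885)
    ⟨by norm_num, by linarith [pi_gt_three]⟩ ⟨hy₀, hy₁⟩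
  have herror : (0.655885 - y) * (log (2 * sin 0.655885) - 0.19862) ≤ 5 / 10 ^ 6 := by
    have hslope : |log (2 * sin 0.655885) - 0.19862| ≤ 5 / 10 ^ 6 := by
      have := abs_le.1 abs_log_two_mul_sin_sub_le
      exact abs_le.2 ⟨by linarith, by linarith⟩
    have hdist : |0.655885 - y| ≤ 1 :=
      abs_le.2 ⟨by linarith [pi_lt_d6], by linarith⟩
    refine (le_abs_self _).trans ?_
    rw [abs_mul]
    exact (mul_le_of_le_one_left (abs_nonneg _) hdist).trans hslope
  have hmain : lobachevsky 0.655885 + 5 / 10 ^ 6 < (π - 0.655885) * 0.19862 := by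
    have hlog := abs_le.1 abs_log_two_mul_sub_le
    have := lobachevsky_le (x := 0.655885) (by norm_num) (by norm_num)
    norm_num at hlog this ⊢
    linarith [pi_gt_d6]
  refine lt_of_mul_lt_mul_left ?_ (by positivity : 0 ≤ π * w)
  rw [pi_mul_log_two_add_meanLogSin ⟨hw₀, hw.2⟩, ← hy, show π * w = π - y by rw [hy]; ring]
  linarith

lemma one_sub_div_pi_mem_Ioo : 1 - 0.655885 / π ∈ Set.Ioo (1 / 2 : ℝ) 1 := by
  have : 0.655885 / π < 1 / 2 := (div_lt_iff₀ pi_pos).2 (by linarith [pi_gt_three])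
  exact ⟨by linarith, sub_lt_self _ (by positivity)⟩

lemma lt_log_two_add_meanLogSin : 0.19861 < log 2 + meanLogSin (1 - 0.655885 / π) := by
  have hw : 1 - 0.655885 / π ∈ Set.Ioc 0 1 :=
    ⟨by linarith [one_sub_div_pi_mem_Ioo.1], one_sub_div_pi_mem_Ioo.2.le⟩
  have hmain : (π - 0.655885) * 0.19861 < lobachevsky 0.655885 := by
    have hlog := abs_le.1 abs_log_two_mul_sub_le
    have := le_lobachevsky (x := 0.655885) (by norm_num) (by norm_num)
    norm_num at hlog this ⊢
    linarith [pi_lt_d6]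
  have hmul : π * (1 - 0.655885 / π) = π - 0.655885 := by field_simp
  have hpos : 0 < π - 0.655885 := by linarith [pi_gt_three]
  have hvalue := pi_mul_log_two_add_meanLogSin hw
  rw [hmul, sub_sub_cancel, mul_div_cancel₀ _ pi_ne_zero] at hvalue
  exact lt_of_mul_lt_mul_left (hvalue ▸ hmain) hpos.le

lemma log_two_add_meanLogSin_half : log 2 + meanLogSin (1 / 2) = 0 := by
  have := integral_logDist_zero_half (r := 1) (by norm_num)
  rw [integral_logDist_one (by norm_num)] at this
  linarith

lemma log_two_add_meanLogSin_one : log 2 + meanLogSin 1 = 0 := by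
  have := integral_logDist_zero_one (r := 1) (by norm_num)
  rwa [integral_logDist_one (by norm_num), one_mul] at this

lemma continuousOn_meanLogSin : ContinuousOn meanLogSin (Set.Icc (1 / 2) 1) :=
  (continuousOn_id.inv₀ fun w hw => by simp only [id_eq]; linarith [hw.1]).mul
    (continuous_primitive intervalIntegrable_log_sin_pi_mul 0).continuousOn

lemma exists_isGreatest_meanLogSin :
    ∃ w ∈ Set.Ioo (1 / 2 : ℝ) 1,
      IsGreatest (meanLogSin '' Set.Ioo (1 / 2) 1) (meanLogSin w) := by
  obtain ⟨w, hw, hmax⟩ := isCompact_Icc.exists_isMaxOn ⟨1, by norm_num⟩ continuousOn_meanLogSin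
  have hlarge := lt_log_two_add_meanLogSin.trans_le <| add_le_add_right
    (hmax (Set.Ioo_subset_Icc_self one_sub_div_pi_mem_Ioo)) (log 2)
  have hhalf : w ≠ 1 / 2 := by
    rintro rfl
    linarith [log_two_add_meanLogSin_half]
  have hone : w ≠ 1 := by
    rintro rfl
    linarith [log_two_add_meanLogSin_one]
  have hw' : w ∈ Set.Ioo (1 / 2 : ℝ) 1 := ⟨hw.1.lt_of_ne' hhalf, hw.2.lt_of_ne hone⟩
  exact ⟨w, hw', Set.mem_image_of_mem _ hw',
    Set.forall_mem_image.2 fun u hu => hmax (Set.Ioo_subset_Icc_self hu)⟩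

/-- The paper's constant `K`. -/
noncomputable def growthConst : ℝ := log 2 + sSup (meanLogSin '' Set.Ioo (1 / 2) 1)

lemma exists_growthConst_eq :
    ∃ w ∈ Set.Ioo (1 / 2 : ℝ) 1, growthConst = log 2 + meanLogSin w := by
  obtain ⟨w, hw, hmax⟩ := exists_isGreatest_meanLogSin
  exact ⟨w, hw, by rw [growthConst, hmax.csSup_eq]⟩

lemma isGreatest_meanLogSin :
    IsGreatest (meanLogSin '' Set.Ioo (1 / 2) 1) (growthConst - log 2) := by
  obtain ⟨w, -, hmax⟩ := exists_isGreatest_meanLogSin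
  rwa [growthConst, hmax.csSup_eq, add_sub_cancel_left]

lemma log_two_add_meanLogSin_le_growthConst {w : ℝ} (hw : w ∈ Set.Ioo (1 / 2) 1) :
    log 2 + meanLogSin w ≤ growthConst :=
  le_sub_iff_add_le'.1 (isGreatest_meanLogSin.2 (Set.mem_image_of_mem _ hw))

lemma lt_growthConst : 0.19861 < growthConst :=
  lt_log_two_add_meanLogSin.trans_le
    (log_two_add_meanLogSin_le_growthConst one_sub_div_pi_mem_Ioo)

lemma growthConst_lt : growthConst < 0.19862 := by
  obtain ⟨w, hw, hK⟩ := exists_growthConst_eq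
  exact hK ▸ log_two_add_meanLogSin_lt (Set.Ioo_subset_Icc_self hw)

lemma integral_logDist_le_growthConst_mul_fract {r : ℝ} (hr₀ : 0 ≤ r) (hr₁ : r ≤ 1) (x : ℝ) :
    ∫ t in 0..x, logDist r t ≤ growthConst * Int.fract x := by
  have hK : 0 ≤ growthConst := by linarith [lt_growthConst]
  rw [← integral_logDist_fract (abs_le.2 ⟨by linarith, hr₁⟩)]
  obtain ⟨w, hw⟩ : ∃ w, w = Int.fract x := ⟨_, rfl⟩
  rw [← hw]
  have hw₀ : 0 ≤ w := hw ▸ Int.fract_nonneg x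
  have hw₁ : w < 1 := hw ▸ Int.fract_lt_one x
  rcases le_or_gt w (1 / 2) with hsmall | hlarge
  · exact (integral_logDist_nonpos hr₀ hr₁ ⟨hw₀, hsmall⟩).trans (mul_nonneg hK hw₀)
  · calc ∫ t in 0..w, logDist r t ≤ ∫ t in 0..w, logDist 1 t :=
          integral_logDist_le_integral_logDist_one hr₀ hr₁ ⟨hlarge.le, hw₁.le⟩
      _ = (log 2 + meanLogSin w) * w := by
          rw [integral_logDist_one ⟨by linarith, hw₁.le⟩, mul_comm]
      _ ≤ growthConst * w := by
          gcongr
          exact log_two_add_meanLogSin_le_growthConst ⟨hlarge, hw₁⟩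

end GrowthConstant

section ExpSum

/-- The exponential sum `∑_{j=1}^n e(jα)`; these sums are the Fourier coefficients of the
logarithm of the smoothed Sudler product. -/
noncomputable def expSum (n : ℕ) (α : ℝ) : ℂ := ∑ j ∈ Finset.Icc 1 n, (𝐞 (j * α) : ℂ)

lemma norm_expSum_le (n : ℕ) (α : ℝ) : ‖expSum n α‖ ≤ n := by
  simpa [expSum] using
    norm_sum_le_of_le (Finset.Icc 1 n) fun j _ => (Circle.norm_coe (𝐞 (j * α))).le

lemma fourierChar_add_intCast (t : ℝ) (k : ℤ) : 𝐞 (t + k) = 𝐞 t := by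
  have h : (𝐞 (k : ℝ) : ℂ) = 1 := by
    rw [fourierChar_apply, Complex.exp_eq_one_iff]
    exact ⟨k, by push_cast; ring⟩
  rw [AddChar.map_add_eq_mul, Circle.coe_eq_one.1 h, mul_one]

lemma norm_one_sub_fourierChar (t : ℝ) : ‖1 - (𝐞 t : ℂ)‖ = 2 * |sin (π * t)| := by
  have h := norm_one_sub_mul_fourierChar_sq 1 t
  rw [Complex.ofReal_one, one_mul] at h
  refine (pow_left_inj₀ (norm_nonneg _) (by positivity) two_ne_zero).1 ?_
  rw [h, mul_pow, sq_abs]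
  ring

lemma four_mul_abs_sub_round_le (α : ℝ) : 4 * |α - round α| ≤ ‖1 - (𝐞 α : ℂ)‖ := by
  have hper : 𝐞 α = 𝐞 (α - round α) := by
    rw [← fourierChar_add_intCast (α - round α) (round α), sub_add_cancel]
  have hsin := mul_abs_le_abs_sin (x := π * (α - round α)) (by
    rw [abs_mul, abs_of_pos pi_pos]
    nlinarith [abs_sub_round α, pi_pos])
  rw [abs_mul, abs_of_pos pi_pos, ← mul_assoc, div_mul_cancel₀ _ pi_ne_zero] at hsin
  rw [hper, norm_one_sub_fourierChar]
  linarith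

lemma norm_expSum_mul_norm_one_sub_le (n : ℕ) (α : ℝ) : ‖expSum n α‖ * ‖1 - (𝐞 α : ℂ)‖ ≤ 2 := by
  have hgeom : expSum n α = 𝐞 α * ∑ j ∈ Finset.range n, (𝐞 α : ℂ) ^ j := by
    rw [expSum, sum_Icc_one_eq_sum_range, Finset.mul_sum]
    refine Finset.sum_congr rfl fun j _ => ?_
    rw [← nsmul_eq_mul, AddChar.map_nsmul_eq_pow, Circle.coe_pow, pow_succ']
  rw [hgeom, ← norm_mul, mul_assoc, geom_sum_mul_neg, norm_mul, Circle.norm_coe, one_mul]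
  refine (norm_sub_le _ _).trans_eq ?_
  rw [norm_pow, Circle.norm_coe, one_pow, norm_one, one_add_one_eq_two]

lemma norm_expSum_mul_abs_sub_round_le (n : ℕ) (α : ℝ) :
    ‖expSum n α‖ * (2 * |α - round α|) ≤ 1 := by
  have := mul_le_mul_of_nonneg_left (four_mul_abs_sub_round_le α) (norm_nonneg (expSum n α))
  linarith [norm_expSum_mul_norm_one_sub_le n α]

lemma one_le_two_mul_den_mul_abs_sub {x : ℚ} {θ : ℝ} {m : ℕ} (k : ℤ)
    (hθ : 2 * m * |x.den * θ - x.num| ≤ 1) (hm : ¬ x.den ∣ m) :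
    1 ≤ 2 * x.den * |m * θ - k| := by
  have hne : m * x.num - x.den * k ≠ 0 := fun h => by
    have hdvd : (x.den : ℤ) ∣ m * x.num := ⟨k, by linarith⟩
    exact hm (Int.natCast_dvd_natCast.1 (x.isCoprime_num_den.symm.dvd_of_dvd_mul_right hdvd))
  have hone : (1 : ℝ) ≤ |m * (x.num : ℝ) - x.den * k| := by exact_mod_cast Int.one_le_abs hne
  have hsplit : m * (x.num : ℝ) - x.den * k = x.den * (m * θ - k) - m * (x.den * θ - x.num) := by
    ring
  rw [hsplit] at hone
  have htri := abs_sub (x.den * (m * θ - k)) (m * (x.den * θ - x.num))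
  rw [abs_mul, abs_mul, Nat.abs_cast, Nat.abs_cast] at htri
  linarith

lemma norm_expSum_le_den {x : ℚ} {θ : ℝ} {m : ℕ} (n : ℕ)
    (hθ : 2 * m * |x.den * θ - x.num| ≤ 1) (hm : ¬ x.den ∣ m) :
    ‖expSum n (m * θ)‖ ≤ x.den := by
  have hfar := one_le_two_mul_den_mul_abs_sub (round (m * θ)) hθ hm
  have hsum := norm_expSum_mul_abs_sub_round_le n (m * θ)
  calc ‖expSum n (m * θ)‖ ≤ ‖expSum n (m * θ)‖ * (2 * x.den * |m * θ - round (m * θ)|) :=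
        le_mul_of_one_le_right (norm_nonneg _) hfar
    _ = x.den * (‖expSum n (m * θ)‖ * (2 * |m * θ - round (m * θ)|)) := by ring
    _ ≤ x.den := mul_le_of_le_one_right (Nat.cast_nonneg _) hsum

end ExpSum

section LogSudler

/-- The logarithm of the smoothed Sudler product `∏_{j=1}^n |1 - r e(jθ)|`. -/
noncomputable def logSudler (r : ℝ) (n : ℕ) (θ : ℝ) : ℝ :=
  ∑ j ∈ Finset.Icc 1 n, logDist r (j * θ)

variable {r : ℝ}

lemma logSudler_sub_intCast (r : ℝ) (n : ℕ) (θ : ℝ) (a : ℤ) :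
    logSudler r n (θ - a) = logSudler r n θ := by
  refine Finset.sum_congr rfl fun j _ => ?_
  have h := (periodic_logDist r).sub_int_mul_eq (x := j * θ) (j * a)
  rw [← h]
  push_cast
  ring_nf

lemma logSudler_abs (r : ℝ) (n : ℕ) (θ : ℝ) : logSudler r n |θ| = logSudler r n θ := by
  rcases abs_choice θ with h | h <;> rw [h]
  simp only [logSudler, mul_neg, logDist_neg]

lemma logSudler_zero_right_nonpos (hr₀ : 0 ≤ r) (hr₁ : r ≤ 1) (n : ℕ) : logSudler r n 0 ≤ 0 := by
  refine Finset.sum_nonpos fun j _ => ?_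
  rw [mul_zero, logDist_zero_right]
  exact log_nonpos (by linarith) (by linarith)

lemma hasSum_logDist (hr : |r| < 1) (t : ℝ) :
    HasSum (fun m : ℕ => r ^ m / m * (𝐞 (m * t) : ℂ).re) (-logDist r t) := by
  have hz : ‖(r : ℂ) * 𝐞 t‖ < 1 := by
    rwa [norm_mul, Circle.norm_coe, mul_one, Complex.norm_real]
  have h := Complex.hasSum_re (Complex.hasSum_taylorSeries_neg_log hz)
  rw [Complex.neg_re, Complex.log_re] at h
  refine h.congr_fun fun m => ?_
  rw [mul_pow, ← Circle.coe_pow, ← AddChar.map_nsmul_eq_pow, nsmul_eq_mul, mul_div_right_comm,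
    ← Complex.ofReal_pow, ← Complex.ofReal_natCast, ← Complex.ofReal_div, Complex.re_ofReal_mul]

lemma hasSum_logSudler (hr : |r| < 1) (n : ℕ) (θ : ℝ) :
    HasSum (fun m : ℕ => r ^ m / m * (expSum n (m * θ)).re) (-logSudler r n θ) := by
  have h := hasSum_sum (s := Finset.Icc 1 n) fun j _ => hasSum_logDist hr (j * θ)
  rw [Finset.sum_neg_distrib] at h
  refine h.congr_fun fun m => ?_
  rw [expSum, Complex.re_sum, Finset.mul_sum]
  exact Finset.sum_congr rfl fun j _ => by rw [mul_left_comm]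

lemma hasSum_logSudler_multiples (hr : |r| < 1) (n : ℕ) (θ : ℝ) {q : ℕ} (hq : 0 < q) :
    HasSum (fun m : ℕ => if q ∣ m then r ^ m / m * (expSum n (m * θ)).re else 0)
      (-((q : ℝ)⁻¹ * logSudler (r ^ q) n (q * θ))) := by
  have hinj : Function.Injective fun m : ℕ => q * m := mul_right_injective₀ hq.ne'
  have hrq : |r ^ q| < 1 := by
    rw [abs_pow]
    exact pow_lt_one₀ (abs_nonneg r) hr hq.ne'
  rw [← hinj.hasSum_iff fun m hm => if_neg fun ⟨x, hx⟩ => hm ⟨x, hx.symm⟩, ← mul_neg]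
  refine ((hasSum_logSudler hrq n (q * θ)).mul_left (q : ℝ)⁻¹).congr_fun fun m => ?_
  simp only [Function.comp_apply, dvd_mul_right, if_true]
  rw [← pow_mul, Nat.cast_mul, mul_comm (q : ℝ) m, mul_assoc (m : ℝ), div_mul_eq_div_div,
    ← div_eq_inv_mul, div_mul_eq_mul_div]

lemma abs_le_of_hasSum_of_le {f : ℕ → ℝ} {a D ρ c : ℝ} (hf : HasSum f a) (k : ℕ)
    (hρ₀ : 0 ≤ ρ) (hρ₁ : ρ < 1) (hhead : ∀ m < k, |f m| ≤ D)
    (htail : ∀ m, k ≤ m → |f m| ≤ c * ρ ^ m) :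
    |a| ≤ k * D + c * (ρ ^ k / (1 - ρ)) := by
  have hgeom : HasSum (fun m => c * ρ ^ (m + k)) (c * (ρ ^ k / (1 - ρ))) := by
    simp only [pow_add, mul_comm _ (ρ ^ k), div_eq_mul_inv]
    exact ((hasSum_geometric_of_lt_one hρ₀ hρ₁).mul_left _).mul_left c
  have hrest : |a - ∑ i ∈ Finset.range k, f i| ≤ c * (ρ ^ k / (1 - ρ)) :=
    ((hasSum_nat_add_iff' k).2 hf).norm_le_of_bounded hgeom fun m => htail _ (Nat.le_add_left _ _)
  have hfirst : |∑ i ∈ Finset.range k, f i| ≤ k * D := by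
    simpa using norm_sum_le_of_le (f := f) (Finset.range k) fun i hi =>
      hhead i (Finset.mem_range.1 hi)
  calc |a| = |∑ i ∈ Finset.range k, f i + (a - ∑ i ∈ Finset.range k, f i)| := by
        rw [add_sub_cancel]
    _ ≤ _ := (abs_add_le _ _).trans (add_le_add hfirst hrest)

lemma abs_pow_div_mul_re_le (hr : 0 ≤ r) (m : ℕ) (z : ℂ) : |r ^ m / m * z.re| ≤ ‖z‖ * r ^ m := by
  have hcoeff : r ^ m / m ≤ r ^ m := by
    rcases Nat.eq_zero_or_pos m with rfl | hm
    · simp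
    · exact div_le_self (by positivity) (by exact_mod_cast hm)
  rw [abs_mul, abs_of_nonneg (by positivity : 0 ≤ r ^ m / (m : ℝ)), mul_comm]
  exact mul_le_mul (Complex.abs_re_le_norm z) hcoeff (by positivity) (norm_nonneg z)

lemma abs_logSudler_sub_inv_mul_le (hr₀ : 0 ≤ r) (hr₁ : r < 1) (n k : ℕ) {θ D : ℝ} {q : ℕ}
    (hq : 0 < q) (hD₀ : 0 ≤ D) (hD : ∀ m < k, ¬ q ∣ m → ‖expSum n (m * θ)‖ ≤ D) :
    |logSudler r n θ - (q : ℝ)⁻¹ * logSudler (r ^ q) n (q * θ)| ≤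
      k * D + n * (r ^ k / (1 - r)) := by
  have hr : |r| < 1 := by rwa [abs_of_nonneg hr₀]
  have hsum := (hasSum_logSudler hr n θ).sub (hasSum_logSudler_multiples hr n θ hq)
  rw [← neg_sub_neg, abs_sub_comm]
  refine abs_le_of_hasSum_of_le hsum k hr₀ hr₁ (fun m hm => ?_) fun m _ => ?_
  · split_ifs with hdvd
    · simpa using hD₀
    · rw [sub_zero]
      exact (abs_pow_div_mul_re_le hr₀ m _).trans
        ((mul_le_of_le_one_right (norm_nonneg _) (pow_le_one₀ hr₀ hr₁.le)).trans (hD m hm hdvd))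
  · split_ifs with hdvd
    · simpa using by positivity
    · rw [sub_zero]
      refine (abs_pow_div_mul_re_le hr₀ m _).trans ?_
      gcongr
      exact norm_expSum_le n _

lemma logSudler_le_inv_den_mul_logSudler (hr₀ : 0 ≤ r) (hr₁ : r < 1) (n k : ℕ) {θ : ℝ} {x : ℚ}
    (hθ : 2 * k * |x.den * θ - x.num| ≤ 1) :
    logSudler r n θ ≤ (x.den : ℝ)⁻¹ * logSudler (r ^ x.den) n (x.den * θ - x.num) +
      (k * x.den + n * (r ^ k / (1 - r))) := by
  rw [logSudler_sub_intCast]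
  have h := abs_logSudler_sub_inv_mul_le hr₀ hr₁ n k x.den_pos (Nat.cast_nonneg _) fun m hm =>
    norm_expSum_le_den (θ := θ) n (le_trans (by gcongr) hθ)
  linarith [le_abs_self (logSudler r n θ - (x.den : ℝ)⁻¹ * logSudler (r ^ x.den) n (x.den * θ))]

end LogSudler

section SudlerUpper

/-- The Sudler product `∏_{j=1}^n |1 - e(jθ)|`. -/
noncomputable def sudlerProd (n : ℕ) (θ : ℝ) : ℝ := ∏ j ∈ Finset.Icc 1 n, ‖1 - (𝐞 (j * θ) : ℂ)‖

variable {r : ℝ}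

lemma norm_one_sub_fourierChar_le (hr₀ : 0 ≤ r) (hr₁ : r < 1) (t : ℝ) :
    ‖1 - (𝐞 t : ℂ)‖ ≤ exp (1 - r + logDist r t) := by
  have hne := one_sub_mul_fourierChar_ne_zero_of_lt_one (abs_lt.2 ⟨by linarith, hr₁⟩) t
  have hle : ‖1 - (𝐞 t : ℂ)‖ ≤ (2 - r) * ‖1 - (r : ℂ) * 𝐞 t‖ := by
    refine le_of_sq_le_sq ?_ (mul_nonneg (by linarith) (norm_nonneg _))
    rw [mul_pow, norm_one_sub_mul_fourierChar_sq, norm_one_sub_fourierChar, mul_pow, sq_abs]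
    have hsq : (2 - r) * (1 + r) ≥ 2 := by nlinarith
    calc 2 ^ 2 * sin (π * t) ^ 2
        ≤ ((2 - r) * (1 + r)) ^ 2 * sin (π * t) ^ 2 := by gcongr
      _ = (2 - r) ^ 2 * ((1 - r) ^ 2 * sin (π * t) ^ 2 + 4 * r * sin (π * t) ^ 2) := by ring
      _ ≤ (2 - r) ^ 2 * ((1 - r) ^ 2 + 4 * r * sin (π * t) ^ 2) := by
        gcongr
        exact mul_le_of_le_one_right (sq_nonneg _) (sin_sq_le_one _)
  rw [exp_add, logDist, exp_log (norm_pos_iff.2 hne)]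
  refine hle.trans ?_
  gcongr
  linarith [add_one_le_exp (1 - r)]

lemma sudlerProd_le_exp_logSudler (hr₀ : 0 ≤ r) (hr₁ : r < 1) (n : ℕ) (θ : ℝ) :
    sudlerProd n θ ≤ exp (n * (1 - r) + logSudler r n θ) := by
  calc sudlerProd n θ ≤ ∏ j ∈ Finset.Icc 1 n, exp (1 - r + logDist r (j * θ)) :=
        Finset.prod_le_prod (fun _ _ => norm_nonneg _) fun _ _ =>
          norm_one_sub_fourierChar_le hr₀ hr₁ _
    _ = exp (n * (1 - r) + logSudler r n θ) := by
        rw [← exp_sum, Finset.sum_add_distrib, Finset.sum_const, Nat.card_Icc,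
          Nat.add_sub_cancel, nsmul_eq_mul, logSudler]

lemma integral_abs_deriv_logDist_le (hr₀ : 0 ≤ r) (hr₁ : r < 1) :
    ∫ t in 0..1, |deriv (logDist r) t| ≤ 2 * log (2 / (1 - r)) := by
  have hr : |r| < 1 := abs_lt.2 ⟨by linarith, hr₁⟩
  have hsmooth : ContDiff ℝ 1 (logDist r) := contDiff_logDist hr
  have hint (a b : ℝ) : IntervalIntegrable (fun t => |deriv (logDist r) t|) volume a b :=
    hsmooth.continuous_deriv_one.abs.intervalIntegrable a b
  have hne (t : ℝ) := one_sub_mul_fourierChar_ne_zero_of_lt_one hr t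
  rw [← integral_add_adjacent_intervals (hint 0 (1 / 2)) (hint (1 / 2) 1),
    integral_abs_deriv_of_monotoneOn hsmooth (by norm_num)
      (monotoneOn_logDist hr₀ subset_rfl fun t _ => hne t),
    integral_abs_deriv_of_antitoneOn hsmooth (by norm_num)
      (antitoneOn_logDist hr₀ subset_rfl fun t _ => hne t),
    log_div two_ne_zero (by linarith)]
  linarith [logDist_le_log_two hr.le (1 / 2), log_one_sub_le_logDist hr₀ hr₁ 0,
    log_one_sub_le_logDist hr₀ hr₁ 1]

lemma log_two_div_one_sub_nonneg (hr₀ : 0 ≤ r) (hr₁ : r < 1) : 0 ≤ log (2 / (1 - r)) :=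
  log_nonneg ((one_le_div (by linarith)).2 (by linarith))

lemma logSudler_le_of_fract_le (hr₀ : 0 ≤ r) (hr₁ : r < 1) {c : ℝ} (hc : 0 ≤ c) {n : ℕ} {η : ℝ}
    (hη : Int.fract (n * |η|) ≤ c * (n * |η|)) :
    logSudler r n η ≤ c * (growthConst * n) + 2 * (n * |η| + 1) * log (2 / (1 - r)) := by
  have hK : 0 < growthConst := by linarith [lt_growthConst]
  have hV := log_two_div_one_sub_nonneg hr₀ hr₁
  rcases eq_or_ne η 0 with rfl | hne
  · exact (logSudler_zero_right_nonpos hr₀ hr₁.le n).trans (by positivity)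
  have hpos : 0 < |η| := abs_pos.2 hne
  have hsmooth : ContDiff ℝ 1 (logDist r) := contDiff_logDist (abs_lt.2 ⟨by linarith, hr₁⟩)
  have hper : Function.Periodic (fun t => |deriv (logDist r) t|) 1 := fun t => by
    simp only [← deriv_comp_add_const, (periodic_logDist r).funext]
  have hmain : ∫ t in 0..n * |η|, logDist r t ≤ growthConst * (c * (n * |η|)) :=
    (integral_logDist_le_growthConst_mul_fract hr₀ hr₁.le _).trans (by gcongr)
  have hvar : ∫ t in 0..n * |η|, |deriv (logDist r) t| ≤
      (n * |η| + 1) * (2 * log (2 / (1 - r))) :=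
    (integral_le_add_one_mul_of_periodic hper hsmooth.continuous_deriv_one.abs
      (fun _ => abs_nonneg _) (by positivity)).trans
      (by gcongr; exact integral_abs_deriv_logDist_le hr₀ hr₁)
  rw [← logSudler_abs, ← mul_le_mul_iff_right₀ hpos, logSudler]
  calc |η| * ∑ j ∈ Finset.Icc 1 n, logDist r (j * |η|)
      ≤ _ := mul_sum_le_integral_add_integral_abs_deriv hsmooth hpos.le n
    _ ≤ growthConst * (c * (n * |η|)) + |η| * ((n * |η| + 1) * (2 * log (2 / (1 - r)))) := by
        gcongr
    _ = |η| * (c * (growthConst * n) + 2 * (n * |η| + 1) * log (2 / (1 - r))) := by ring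

lemma logSudler_le (hr₀ : 0 ≤ r) (hr₁ : r < 1) (n : ℕ) (η : ℝ) :
    logSudler r n η ≤ growthConst * n + 2 * (n * |η| + 1) * log (2 / (1 - r)) := by
  have hfract : Int.fract (n * |η|) ≤ 1 * (n * |η|) := by
    rw [one_mul]
    exact sub_le_self _ (Int.cast_nonneg (Int.floor_nonneg.2 (by positivity)))
  simpa using logSudler_le_of_fract_le hr₀ hr₁ zero_le_one hfract

lemma fract_le_half_mul_self {x : ℝ} (hx : 1 ≤ x) : Int.fract x ≤ 1 / 2 * x := by
  have hfloor : (1 : ℝ) ≤ ⌊x⌋ := by exact_mod_cast Int.le_floor.2 (by simpa using hx)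
  linarith [Int.fract_add_floor x, Int.fract_lt_one x]

lemma inv_mul_logSudler_pow_le (hr₀ : 0 ≤ r) (hr₁ : r < 1) {n q : ℕ} {η : ℝ} (hq : 0 < q)
    (hη : q = 1 → 1 ≤ n * |η|) :
    (q : ℝ)⁻¹ * logSudler (r ^ q) n η ≤
      1 / 2 * (growthConst * n) + 2 * (n * |η| + 1) * log (2 / (1 - r)) := by
  have hK : 0 < growthConst := by linarith [lt_growthConst]
  obtain rfl | hq2 := (Nat.one_le_iff_ne_zero.2 hq.ne').eq_or_lt
  · simpa using logSudler_le_of_fract_le hr₀ hr₁ (by norm_num) (fract_le_half_mul_self (hη rfl))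
  have hrq : r ^ q ≤ r := pow_le_of_le_one hr₀ hr₁.le hq.ne'
  have hlog : log (2 / (1 - r ^ q)) ≤ log (2 / (1 - r)) :=
    log_le_log (div_pos two_pos (by linarith)) (by gcongr)
  have hinv : (q : ℝ)⁻¹ ≤ 1 / 2 := by
    rw [one_div]
    exact inv_anti₀ two_pos (by exact_mod_cast hq2)
  have hV := log_two_div_one_sub_nonneg hr₀ hr₁
  calc (q : ℝ)⁻¹ * logSudler (r ^ q) n η
      ≤ (q : ℝ)⁻¹ * (growthConst * n + 2 * (n * |η| + 1) * log (2 / (1 - r ^ q))) := by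
        gcongr
        exact logSudler_le (pow_nonneg hr₀ q) (hrq.trans_lt hr₁) n η
    _ ≤ (q : ℝ)⁻¹ * (growthConst * n + 2 * (n * |η| + 1) * log (2 / (1 - r))) := by gcongr
    _ ≤ 1 / 2 * (growthConst * n + 2 * (n * |η| + 1) * log (2 / (1 - r))) := by gcongr
    _ ≤ 1 / 2 * (growthConst * n) + 2 * (n * |η| + 1) * log (2 / (1 - r)) := by
        have : 0 ≤ 2 * (n * |η| + 1) * log (2 / (1 - r)) := by positivity
        linarith

lemma logSudler_le_of_one_le (hr₀ : 0 ≤ r) (hr₁ : r < 1) {n k N : ℕ} {θ : ℝ} (hN : 0 < N)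
    (hkN : 2 * k ≤ N) (hθ : 1 ≤ n * |θ - round θ|) :
    logSudler r n θ ≤ 1 / 2 * (growthConst * n) + 2 * (n / N + 1) * log (2 / (1 - r)) +
      (k * N + n * (r ^ k / (1 - r))) := by
  have hV := log_two_div_one_sub_nonneg hr₀ hr₁
  have hN' : (0 : ℝ) < N := by exact_mod_cast hN
  obtain ⟨x, hx, hxN⟩ := exists_rat_abs_sub_le_and_den_le θ hN
  have : (0 : ℝ) < x.den := by exact_mod_cast x.den_pos
  have hη : |x.den * θ - x.num| ≤ 1 / N := by
    have hnum : (x.num : ℝ) = x.den * x := by exact_mod_cast x.den_mul_eq_num.symm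
    rw [hnum, ← mul_sub, abs_mul, Nat.abs_cast]
    calc x.den * |θ - x| ≤ x.den * (1 / ((N + 1) * x.den)) := by gcongr
      _ = 1 / (N + 1) := by field_simp
      _ ≤ 1 / N := by gcongr; linarith
  have hk : 2 * k * |x.den * θ - x.num| ≤ 1 := by
    have hkN' : (2 * k : ℝ) ≤ N := by exact_mod_cast hkN
    calc 2 * k * |x.den * θ - x.num| ≤ N * (1 / N) := by gcongr
      _ = 1 := mul_one_div_cancel hN'.ne'
  have hfar : x.den = 1 → 1 ≤ n * |x.den * θ - x.num| := fun h => by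
    rw [h, Nat.cast_one, one_mul]
    exact hθ.trans (mul_le_mul_of_nonneg_left (round_le θ x.num) (Nat.cast_nonneg n))
  refine (logSudler_le_inv_den_mul_logSudler hr₀ hr₁ n k hk).trans ?_
  have hnη : n * |x.den * θ - x.num| ≤ n / N := by
    rw [← mul_one_div (n : ℝ)]
    exact mul_le_mul_of_nonneg_left hη (Nat.cast_nonneg n)
  refine add_le_add ((inv_mul_logSudler_pow_le hr₀ hr₁ x.den_pos hfar).trans ?_) ?_ <;> gcongr

lemma exists_sudlerProd_le_of_one_le :
    ∃ B, ∀ (n : ℕ) (θ : ℝ), 1 ≤ n * |θ - round θ| →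
      sudlerProd n θ ≤ exp (growthConst * n + B) := by
  have hK₀ := lt_growthConst
  have hK₁ := growthConst_lt
  obtain ⟨ρ, hρ⟩ : ∃ ρ, ρ = 1 - growthConst / 8 := ⟨_, rfl⟩
  have hρ₀ : 0 ≤ ρ := by linarith
  have hρ₁ : ρ < 1 := by linarith
  obtain ⟨k, hk⟩ := exists_pow_lt_of_lt_one (y := ρ) (by positivity : 0 < (growthConst / 8) ^ 2) hρ₁
  have htail : ρ ^ k / (1 - ρ) ≤ growthConst / 8 := by
    rw [div_le_iff₀ (by linarith), show 1 - ρ = growthConst / 8 by linarith, ← sq]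
    exact hk.le
  obtain ⟨V, hV⟩ : ∃ V, V = log (2 / (1 - ρ)) := ⟨_, rfl⟩
  obtain ⟨N, hN⟩ := exists_nat_ge (max (2 * k + 1 : ℝ) (V / (growthConst / 16)))
  have hkN : 2 * k + 1 ≤ N := by exact_mod_cast (le_max_left _ _).trans hN
  have hN₀ : (0 : ℝ) < N := by exact_mod_cast (by omega : 0 < N)
  have hVN : V / N ≤ growthConst / 16 := by
    rw [div_le_comm₀ hN₀ (by linarith)]
    exact (le_max_right _ _).trans hN
  refine ⟨2 * V + k * N, fun n θ hθ => (sudlerProd_le_exp_logSudler hρ₀ hρ₁ n θ).trans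
    (exp_le_exp.2 ?_)⟩
  calc n * (1 - ρ) + logSudler ρ n θ
      ≤ n * (1 - ρ) + (1 / 2 * (growthConst * n) + 2 * (n / N + 1) * V +
          (k * N + n * (ρ ^ k / (1 - ρ)))) := by
        rw [hV]
        gcongr
        exact logSudler_le_of_one_le hρ₀ hρ₁ (by omega) (by omega) hθ
    _ = n * (1 - ρ + growthConst / 2 + 2 * (V / N) + ρ ^ k / (1 - ρ)) + (2 * V + k * N) := by ring
    _ ≤ n * growthConst + (2 * V + k * N) := by
        gcongr
        linarith
    _ = growthConst * n + (2 * V + k * N) := by rw [mul_comm]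

lemma sudlerProd_le_of_le_one {n : ℕ} (hn : 2 ≤ n) {θ : ℝ} (hθ : n * |θ - round θ| ≤ 1) :
    sudlerProd n θ ≤ exp (growthConst * n + (1 + 4 * log (2 * n))) := by
  have hn' : (2 : ℝ) ≤ n := by exact_mod_cast hn
  have hn₀ : (0 : ℝ) < n := by linarith
  have hr₀ : 0 ≤ 1 - (n : ℝ)⁻¹ := sub_nonneg.2 (inv_le_one_of_one_le₀ (by linarith))
  have hr₁ : 1 - (n : ℝ)⁻¹ < 1 := sub_lt_self _ (inv_pos.2 hn₀)
  have hlog : 0 ≤ log (2 * n) := log_nonneg (by linarith)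
  refine (sudlerProd_le_exp_logSudler hr₀ hr₁ n θ).trans (exp_le_exp.2 ?_)
  have hle := logSudler_le hr₀ hr₁ n (θ - round θ)
  rw [logSudler_sub_intCast, sub_sub_cancel, div_inv_eq_mul] at hle
  rw [sub_sub_cancel, mul_inv_cancel₀ hn₀.ne']
  have : 2 * (n * |θ - round θ| + 1) * log (2 * n) ≤ 2 * (1 + 1) * log (2 * n) := by gcongr
  linarith

lemma exists_sudlerProd_le :
    ∃ A, ∀ n : ℕ, 2 ≤ n → ∀ θ, sudlerProd n θ ≤ exp (growthConst * n + (A + 4 * log n)) := by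
  obtain ⟨B, hB⟩ := exists_sudlerProd_le_of_one_le
  refine ⟨max B (1 + 4 * log 2), fun n hn θ => ?_⟩
  have hn₀ : (n : ℝ) ≠ 0 := by positivity
  have hlog : 0 ≤ log n := log_natCast_nonneg n
  rcases le_total 1 (n * |θ - round θ|) with h | h
  · refine (hB n θ h).trans (exp_le_exp.2 ?_)
    linarith [le_max_left B (1 + 4 * log 2)]
  · refine (sudlerProd_le_of_le_one hn h).trans (exp_le_exp.2 ?_)
    rw [log_mul two_ne_zero hn₀]
    linarith [le_max_right B (1 + 4 * log 2)]

end SudlerUpper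

section SudlerLower

lemma sudlerProd_nonneg (n : ℕ) (θ : ℝ) : 0 ≤ sudlerProd n θ :=
  Finset.prod_nonneg fun _ _ => norm_nonneg _

lemma exp_logSudler_one {n : ℕ} {θ : ℝ} (hθ : 0 < θ) (hnθ : n * θ < 1) :
    exp (logSudler 1 n θ) = sudlerProd n θ := by
  rw [logSudler, exp_sum, sudlerProd]
  refine Finset.prod_congr rfl fun j hj => ?_
  obtain ⟨hj₁, hjn⟩ := Finset.mem_Icc.1 hj
  have hmem : j * θ ∈ Set.Ioo 0 1 :=
    ⟨mul_pos (by exact_mod_cast hj₁) hθ, lt_of_le_of_lt (by gcongr) hnθ⟩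
  have hne := one_sub_mul_fourierChar_ne_zero_of_mem_Ioo zero_le_one hmem
  rw [logDist, exp_log (norm_pos_iff.2 hne), Complex.ofReal_one, one_mul]

lemma exp_le_sudlerProd {w : ℝ} (hw : w ∈ Set.Ioo (1 / 2) 1) {n : ℕ} (hn : 0 < n) :
    exp ((log 2 + meanLogSin w) * n - (log 2 - logDist 1 w)) ≤ sudlerProd n (w / n) := by
  have hw₀ : 0 < w := one_half_pos.trans hw.1
  have hn' : (0 : ℝ) < n := by exact_mod_cast hn
  have hnw : n * (w / n) = w := mul_div_cancel₀ w hn'.ne'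
  have hmono : MonotoneOn (logDist 1) (Set.Ioc 0 (1 / 2)) :=
    monotoneOn_logDist zero_le_one Set.Ioc_subset_Icc_self fun t ht =>
      one_sub_mul_fourierChar_ne_zero_of_mem_Ioo zero_le_one ⟨ht.1, ht.2.trans_lt one_half_lt_one⟩
  have hanti : AntitoneOn (logDist 1) (Set.Icc (1 / 2) w) :=
    antitoneOn_logDist zero_le_one (Set.Icc_subset_Icc_right hw.2.le) fun t ht =>
      one_sub_mul_fourierChar_ne_zero_of_mem_Ioo zero_le_one
        ⟨one_half_pos.trans_le ht.1, ht.2.trans_lt hw.2⟩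
  have hhalf : logDist 1 (1 / 2) = log 2 := by
    rw [logDist_one_left, mul_one_div, sin_pi_div_two, mul_one]
  have hsum := integral_le_mul_sum_of_monotoneOn_of_antitoneOn (f := logDist 1) (n := n)
    (h := w / n) one_half_pos.le (by positivity) (by rw [hnw]; exact hw.1.le) hmono
    (by rwa [hnw]) (intervalIntegrable_logDist 1 _ _)
  rw [hnw, integral_logDist_one ⟨hw₀, hw.2.le⟩, hhalf, div_mul_eq_mul_div, le_div_iff₀ hn',
    mul_assoc, mul_le_mul_iff_right₀ hw₀] at hsum
  rw [← exp_logSudler_one (by positivity) (by rw [hnw]; exact hw.2), logSudler]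
  exact exp_le_exp.2 (by linarith)

lemma exists_exp_le_sudlerProd :
    ∃ c, ∀ n : ℕ, 0 < n → ∃ θ, exp (growthConst * n - c) ≤ sudlerProd n θ := by
  obtain ⟨w, hw, hK⟩ := exists_growthConst_eq
  exact ⟨_, fun n hn => ⟨_, hK ▸ exp_le_sudlerProd hw hn⟩⟩

end SudlerLower

section MaxCoeff

lemma norm_coeff_le_of_forall_norm_eval_fourierChar_le {p : ℂ[X]} {M : ℝ}
    (h : ∀ θ : ℝ, ‖p.eval (𝐞 θ : ℂ)‖ ≤ M) (j : ℕ) : ‖p.coeff j‖ ≤ M := by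
  have hM : 0 ≤ M := (norm_nonneg _).trans (h 0)
  have hcoeff : ‖p.coeff j‖ ^ 2 ≤ ∑ i ∈ p.support, ‖p.coeff i‖ ^ 2 := by
    by_cases hj : j ∈ p.support
    · exact Finset.single_le_sum (f := fun i => ‖p.coeff i‖ ^ 2) (fun i _ => sq_nonneg _) hj
    · rw [notMem_support_iff.1 hj, norm_zero, zero_pow two_ne_zero]
      exact Finset.sum_nonneg fun i _ => sq_nonneg _
  have hcont : Continuous fun t : ℝ => ‖p.eval (𝐞 t : ℂ)‖ ^ 2 := by
    have : Continuous fun t : ℝ => (𝐞 t : ℂ) := continuous_subtype_val.comp continuous_fourierChar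
    fun_prop
  have hint : ∫ t in 0..1, ‖p.eval (𝐞 t : ℂ)‖ ^ 2 ≤ M ^ 2 := by
    have := integral_mono_on (μ := volume) zero_le_one (hcont.intervalIntegrable 0 1)
      (intervalIntegrable_const (c := M ^ 2)) fun t _ => by gcongr; exact h t
    simpa using this
  rw [p.sum_sq_norm_coeff_eq_circleAverage, circleAverage_eq_integral_fourierChar] at hcoeff
  exact le_of_sq_le_sq (hcoeff.trans hint) hM

lemma norm_eval_truncProd_fourierChar (s n : ℕ) (θ : ℝ) :
    ‖((truncProd s n).map (Int.castRingHom ℂ)).eval (𝐞 θ : ℂ)‖ = sudlerProd n θ ^ s := by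
  rw [truncProd, Polynomial.map_prod, eval_prod, norm_prod, sudlerProd, ← Finset.prod_pow]
  refine Finset.prod_congr rfl fun j _ => ?_
  rw [← nsmul_eq_mul, AddChar.map_nsmul_eq_pow]
  simp

lemma natDegree_truncProd_le (s n : ℕ) : (truncProd s n).natDegree ≤ truncDeg s n := by
  have hfactor (j : ℕ) : ((1 : ℤ[X]) - X ^ j).natDegree ≤ j :=
    (natDegree_sub_le _ _).trans (by simp)
  calc (truncProd s n).natDegree
      ≤ ∑ j ∈ Finset.Icc 1 n, ((1 - X ^ j : ℤ[X]) ^ s).natDegree := natDegree_prod_le _ _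
    _ ≤ ∑ j ∈ Finset.Icc 1 n, s * j := Finset.sum_le_sum fun j _ =>
        natDegree_pow_le.trans (Nat.mul_le_mul_left s (hfactor j))
    _ = s * ∑ j ∈ Finset.range (n + 1), j := by
        rw [← Finset.mul_sum, sum_Icc_one_eq_sum_range, Finset.sum_range_succ', add_zero]
    _ = truncDeg s n := by
        refine (Nat.div_eq_of_eq_mul_left two_pos ?_).symm
        rw [mul_assoc s, Finset.sum_range_id_mul_two, Nat.add_sub_cancel]
        ring

lemma one_le_maxCoeff (n s : ℕ) : 1 ≤ maxCoeff n s := by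
  have hcoeff : truncCoeff 0 s n = 1 := by
    rw [truncCoeff, coeff_zero_eq_eval_zero, truncProd, eval_prod]
    refine Finset.prod_eq_one fun j hj => ?_
    have : j ≠ 0 := Nat.one_le_iff_ne_zero.1 (Finset.mem_Icc.1 hj).1
    simp [this]
  have := Finset.le_sup' (fun j => |truncCoeff j s n|) (Finset.mem_range.2 (truncDeg s n).succ_pos)
  rwa [hcoeff, abs_one] at this

lemma maxCoeff_le_pow {n : ℕ} {M : ℝ} (h : ∀ θ, sudlerProd n θ ≤ M) (s : ℕ) :
    (maxCoeff n s : ℝ) ≤ M ^ s := by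
  obtain ⟨j, -, hj⟩ := Finset.exists_mem_eq_sup' (s := Finset.range (truncDeg s n + 1))
    Finset.nonempty_range_add_one fun j => |truncCoeff j s n|
  have hcoeff := norm_coeff_le_of_forall_norm_eval_fourierChar_le
    (p := (truncProd s n).map (Int.castRingHom ℂ)) (fun θ => by
      rw [norm_eval_truncProd_fourierChar]
      exact pow_le_pow_left₀ (sudlerProd_nonneg n θ) (h θ) s) j
  rwa [coeff_map, eq_intCast, Complex.norm_intCast, ← Int.cast_abs, ← truncCoeff, ← hj] at hcoeff

lemma sudlerProd_pow_le (s n : ℕ) (θ : ℝ) :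
    sudlerProd n θ ^ s ≤ (truncDeg s n + 1 : ℕ) * maxCoeff n s := by
  rw [← norm_eval_truncProd_fourierChar, eval_eq_sum_range' (n := truncDeg s n + 1)
    (Nat.lt_succ_of_le (natDegree_map_le.trans (natDegree_truncProd_le s n)))]
  have hterm (j : ℕ) (hj : j ∈ Finset.range (truncDeg s n + 1)) :
      ‖((truncProd s n).map (Int.castRingHom ℂ)).coeff j * (𝐞 θ : ℂ) ^ j‖ ≤ maxCoeff n s := by
    rw [norm_mul, norm_pow, Circle.norm_coe, one_pow, mul_one, coeff_map, eq_intCast,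
      Complex.norm_intCast, ← Int.cast_abs]
    exact_mod_cast Finset.le_sup' (fun j => |truncCoeff j s n|) hj
  simpa using norm_sum_le_of_le _ hterm

lemma truncDeg_add_one_le {s n : ℕ} (hs : 0 < s) (hn : 0 < n) :
    truncDeg s n + 1 ≤ 2 * s * n ^ 2 := by
  have hdeg : truncDeg s n ≤ s * n ^ 2 := by
    refine Nat.div_le_of_le_mul ?_
    calc n * (n + 1) * s ≤ n * (n + n) * s := by gcongr; exact hn
      _ = 2 * (s * n ^ 2) := by ring
  have hpos : 0 < s * n ^ 2 := by positivity
  linarith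

lemma exists_log_maxCoeff_le (s : ℕ) :
    ∃ A, ∀ n : ℕ, 2 ≤ n → log (maxCoeff n s) ≤ s * growthConst * n + (A + 4 * s * log n) := by
  obtain ⟨A, hA⟩ := exists_sudlerProd_le
  refine ⟨s * A, fun n hn => ?_⟩
  have hpos : (0 : ℝ) < maxCoeff n s := by exact_mod_cast one_le_maxCoeff n s
  have hle := log_le_log hpos (maxCoeff_le_pow (hA n hn) s)
  rw [log_pow, log_exp] at hle
  linarith

lemma exists_le_log_maxCoeff {s : ℕ} (hs : 0 < s) :
    ∃ A, ∀ n : ℕ, 0 < n → s * growthConst * n - (A + 2 * log n) ≤ log (maxCoeff n s) := by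
  obtain ⟨c, hc⟩ := exists_exp_le_sudlerProd
  refine ⟨s * c + log (2 * s), fun n hn => ?_⟩
  obtain ⟨θ, hθ⟩ := hc n hn
  have hpos : (0 : ℝ) < maxCoeff n s := by exact_mod_cast one_le_maxCoeff n s
  have hdeg : ((truncDeg s n + 1 : ℕ) : ℝ) ≤ 2 * s * n ^ 2 := by
    exact_mod_cast truncDeg_add_one_le hs hn
  have hle : exp (growthConst * n - c) ^ s ≤ 2 * s * n ^ 2 * maxCoeff n s :=
    calc exp (growthConst * n - c) ^ s ≤ sudlerProd n θ ^ s := by gcongr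
      _ ≤ (truncDeg s n + 1 : ℕ) * maxCoeff n s := sudlerProd_pow_le s n θ
      _ ≤ 2 * s * n ^ 2 * maxCoeff n s := by gcongr
  have hlog := log_le_log (by positivity) hle
  rw [log_pow, log_exp, log_mul (by positivity) hpos.ne', log_mul (by positivity) (by positivity),
    log_pow] at hlog
  push_cast at hlog
  linarith

lemma isBigO_log_natCast_of_le_of_le {f : ℕ → ℝ} {A B A' B' : ℝ}
    (hlower : ∀ᶠ n : ℕ in atTop, -(A + B * log n) ≤ f n)
    (hupper : ∀ᶠ n : ℕ in atTop, f n ≤ A' + B' * log n) :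
    f =O[atTop] fun n : ℕ => log n := by
  have hlin (a b : ℝ) : (fun n : ℕ => a + b * log n) =O[atTop] fun n : ℕ => log n :=
    (isLittleO_const_log_atTop.comp_tendsto tendsto_natCast_atTop_atTop).isBigO.add
      (isBigO_const_mul_self b _ _)
  refine IsBigO.trans (.of_bound 1 ?_) ((hlin A B).norm_left.add (hlin A' B').norm_left)
  filter_upwards [hlower, hupper] with n hl hu
  rw [one_mul, norm_eq_abs, norm_of_nonneg (by positivity), norm_eq_abs, norm_eq_abs, abs_le]
  constructor
  · linarith [le_abs_self (A + B * log n), abs_nonneg (A' + B' * log n)]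
  · linarith [le_abs_self (A' + B' * log n), abs_nonneg (A + B * log n)]

lemma isBigO_log_maxCoeff_sub {s : ℕ} (hs : 0 < s) :
    (fun n : ℕ => log (maxCoeff n s) - s * growthConst * n) =O[atTop] fun n : ℕ => log n := by
  obtain ⟨A, hA⟩ := exists_le_log_maxCoeff hs
  obtain ⟨A', hA'⟩ := exists_log_maxCoeff_le s
  refine isBigO_log_natCast_of_le_of_le (A := A) (B := 2) (A' := A') (B' := 4 * s) ?_ ?_
  · filter_upwards [eventually_gt_atTop 0] with n hn
    linarith [hA n hn]
  · filter_upwards [eventually_ge_atTop 2] with n hn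
    linarith [hA' n hn]

end MaxCoeff

theorem theorem3p10 :
    ∃ m K : ℝ,
      IsGreatest (meanLogSin '' Set.Ioo (1 / 2 : ℝ) 1) m ∧
      K = Real.log 2 + m ∧
      0.19861 < K ∧ K < 0.19862 ∧
      ∀ s : ℕ, 1 ≤ s →
        ∃ E : ℕ → ℝ,
          E =O[Filter.atTop] (fun n : ℕ => Real.log (n : ℝ)) ∧
          ∀ᶠ n : ℕ in Filter.atTop,
            (maxCoeff n s : ℝ) = Real.exp ((s : ℝ) * K * (n : ℝ) + E n) := by
  refine ⟨growthConst - log 2, growthConst, isGreatest_meanLogSin, by ring, lt_growthConst,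
    growthConst_lt, fun s hs => ⟨_, isBigO_log_maxCoeff_sub hs, .of_forall fun n => ?_⟩⟩
  have hpos : (0 : ℝ) < maxCoeff n s := by exact_mod_cast one_le_maxCoeff n s
  rw [add_sub_cancel, exp_log hpos]
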